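/- For a finite field $F$ and a real number $\lambda$, call a set $A\subseteq F$ a $(1,\lambda)$-antifield if $|A\cap(aG+b)|\le\max\{\lambda,|G|^{1/2}\}$ for all subfields $G$ of $F$ and all $a,b\in F$. Call $A$ a $(1,\lambda)$-strong-antifield if it is a $(1,\lambda)$-antifield and, for every subfield $G$ of $F$ with $|G|\ge\lambda$, the set $A$ intersects strictly fewer than $\tfrac12\max\{\lambda,|G|^{1/2}\}$ distinct translates $G+b$ $(b\in F)$ of $G$. Call a set $P\subseteq F\times F$ a $(2,\lambda)$-strong-antifield if $\{x\in F: (x,y)\in P\text{ for some }y\in F\}$ is a $(1,\lambda)$-strong-antifield. For a finite set $P$ of points and a finite set $L$ of lines in $F\times F$, let $I(P,L)=|\{(p,l)\in P\times L: p\in l\}|$. **Theorem 1.** There are absolute constants $\gamma>0$ and $C>0$ with the following property. Let $F$ be a finite field, and let $P$ and $L$ be sets of points and lines respectively in $F\times F$ with $|P|=|L|=n$. If $P$ is a $\left(2,\gamma n^{2560/6419}\right)$-strong-antifield, then $$I(P,L)\le C\,n^{\frac32-\frac1{12838}}.$$ -/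

import Mathlib

/-- `A` is a `(1, lam)`-antifield in the finite field `F`: for every subfield `G` and all `a b : F`,
`|A ∩ (aG + b)| ≤ max {lam, |G|^{1/2}}`. -/
def IsAntifield₁ {F : Type*} [Field F] [Finite F] (lam : ℝ) (A : Set F) : Prop :=
  ∀ (G : Subfield F) (a b : F),
    ((A ∩ (fun g : F => a * g + b) '' (G : Set F)).ncard : ℝ)
      ≤ max lam ((Nat.card G : ℝ) ^ (1 / 2 : ℝ))

/-- The set of distinct translates `G + b` (as subsets of `F`) that the set `A` intersects. -/
def translatesMeeting {F : Type*} [Field F] (G : Subfield F) (A : Set F) : Set (Set F) :=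
  {S | (∃ b : F, S = (fun g : F => g + b) '' (G : Set F)) ∧ (A ∩ S).Nonempty}

/-- `A` is a `(1, lam)`-strong-antifield in the finite field `F`: it is a `(1, lam)`-antifield, and
it meets strictly fewer than `max {lam, |G|^{1/2}} / 2` distinct translates of each subfield `G`
with `|G| ≥ lam`. -/
def IsStrongAntifield₁ {F : Type*} [Field F] [Finite F] (lam : ℝ) (A : Set F) : Prop :=
  IsAntifield₁ lam A ∧
    ∀ G : Subfield F, lam ≤ (Nat.card G : ℝ) →
      ((translatesMeeting G A).ncard : ℝ) < max lam ((Nat.card G : ℝ) ^ (1 / 2 : ℝ)) / 2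

/-- `P` is a `(2, lam)`-strong-antifield: its set of first coordinates is a
`(1, lam)`-strong-antifield. -/
def IsStrongAntifield₂ {F : Type*} [Field F] [Finite F] (lam : ℝ) (P : Set (F × F)) : Prop :=
  IsStrongAntifield₁ lam {x : F | ∃ y : F, (x, y) ∈ P}

/-- A subset of the plane `F × F` is a line if it is the solution set of an equation
`a x + b y = c` with `(a, b) ≠ (0, 0)`. -/
def IsPlaneLine {F : Type*} [Field F] (l : Set (F × F)) : Prop :=
  ∃ a b c : F, (a ≠ 0 ∨ b ≠ 0) ∧ l = {p : F × F | a * p.1 + b * p.2 = c}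

open Classical in
/-- `I(P, L)`, the number of pairs `(p, l) ∈ P × L` with `p ∈ l`. -/
noncomputable def incidences {F : Type*} (P : Finset (F × F)) (L : Finset (Set (F × F))) : ℕ :=
  ((P ×ˢ L).filter (fun x => x.1 ∈ x.2)).card

/-! Suppose there are more than `64 n^{3/2} / t` incidences, where `t = n^{1/12838}`. The plan is to
extract a subfield `G` and a Möbius preimage of it containing too many abscissae of `P`.

Projecting from a well-chosen point of `P` (`exists_pencil`) turns the lines through it into
parallel fibres `B m`, and the remaining lines into graphs meeting many fibres. In the new chart the
coordinate on a fibre is the reciprocal of a difference of abscissae. Counting triples of incidences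
on each line (`exists_dense_collinearPairs`) gives two fibres `B m₀`, `B m₁` such that, for many
`m`, a dense graph of pairs `(u, w)` spans lines meeting `B m`. With `r = (m - m₀) / (m₁ - m)` this
says that `u + r w` lies in a dilate of `B m`, so it takes few values along the graph.

Balog–Szemerédi–Gowers for each `r`, a popularity argument and Ruzsa's inequalities give one set `V`
barely expanded by many ratios `r / r₀` (`exists_dilateBounded_of_graphs`). A sum-product pivot
argument puts these ratios in an affine image of a subfield `G` of size comparable to `|V|` up to
powers of `t` (`exists_subfield_of_dilateBounded`). Many of the corresponding points can be taken on
one line, where the abscissa is a Möbius function of `r`.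

The strong antifield hypothesis forbids this (`IsStrongAntifield₁.ncard_moebius_le`). A Möbius
preimage of `G` either lies in one translate of `G` or has at most two points in each translate. The
antifield bound handles the first case, and the bound on the number of translates met handles the
second. -/

/-! ### Möbius preimages of subfields. -/

section MoebiusImages

variable {F : Type*} [Field F]

/-- If the Möbius map `x ↦ (αx + β) / (γx + δ)` sends three points of one translate of a subfield
into that subfield, then every point it sends into the subfield lies in the same translate. -/
lemma sub_mem_of_moebius_mem (G : Subfield F) {α β γ δ b x₁ x₂ x₃ x : F}
    (hdet : α * δ - β * γ ≠ 0)
    (h₁ : γ * x₁ + δ ≠ 0) (h₂ : γ * x₂ + δ ≠ 0) (h₃ : γ * x₃ + δ ≠ 0) (h : γ * x + δ ≠ 0)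
    (g₁ : (α * x₁ + β) / (γ * x₁ + δ) ∈ G) (g₂ : (α * x₂ + β) / (γ * x₂ + δ) ∈ G)
    (g₃ : (α * x₃ + β) / (γ * x₃ + δ) ∈ G) (g : (α * x + β) / (γ * x + δ) ∈ G)
    (h₁₂ : x₁ ≠ x₂) (h₁₃ : x₁ ≠ x₃) (h₂₃ : x₂ ≠ x₃)
    (b₁ : x₁ - b ∈ G) (b₂ : x₂ - b ∈ G) (b₃ : x₃ - b ∈ G) : x - b ∈ G := by
  by_cases hx : x = x₃
  · rwa [hx]
  have key : ∀ u v : F, γ * u + δ ≠ 0 → γ * v + δ ≠ 0 →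
      (α * u + β) / (γ * u + δ) - (α * v + β) / (γ * v + δ)
        = (α * δ - β * γ) * (u - v) / ((γ * u + δ) * (γ * v + δ)) := by
    intro u v hu hv
    rw [div_sub_div _ _ hu hv]
    congr 1
    ring
  set φ : F → F := fun u => (α * u + β) / (γ * u + δ) with hφ
  -- Möbius maps preserve cross ratios. The cross ratio of the images is in `G`, and so are the
  -- differences of `x₁, x₂, x₃`; solving for `x` then gives `x - b ∈ G`.
  have hcr : (φ x - φ x₁) / (φ x - φ x₃) / ((φ x₂ - φ x₁) / (φ x₂ - φ x₃))
      = (x - x₁) / (x - x₃) / ((x₂ - x₁) / (x₂ - x₃)) := by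
    simp only [hφ]
    rw [key x x₁ h h₁, key x x₃ h h₃, key x₂ x₁ h₂ h₁, key x₂ x₃ h₂ h₃]
    have e₁ := sub_ne_zero.2 hx
    have e₂ := sub_ne_zero.2 h₂₃
    have e₃ := sub_ne_zero.2 h₁₂.symm
    field_simp
  have hmem : (x - x₁) / (x - x₃) / ((x₂ - x₁) / (x₂ - x₃)) ∈ G := by
    rw [← hcr]
    exact div_mem (div_mem (sub_mem g g₁) (sub_mem g g₃)) (div_mem (sub_mem g₂ g₁) (sub_mem g₂ g₃))
  have d₂₁ : x₂ - x₁ ∈ G := by simpa using sub_mem b₂ b₁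
  have d₂₃ : x₂ - x₃ ∈ G := by simpa using sub_mem b₂ b₃
  have hk : (x - x₁) / (x - x₃) ∈ G := by
    have := mul_mem hmem (div_mem d₂₁ d₂₃)
    rwa [div_mul_cancel₀] at this
    exact div_ne_zero (sub_ne_zero.2 h₁₂.symm) (sub_ne_zero.2 h₂₃)
  set k := (x - x₁) / (x - x₃) with hkdef
  have hxx : x - x₃ ≠ 0 := sub_ne_zero.2 hx
  have e : x - x₁ = k * (x - x₃) := by rw [hkdef]; field_simp
  have hk1 : 1 - k ≠ 0 := by
    intro h0
    have : k = 1 := by linear_combination -h0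
    rw [this] at e
    exact h₁₃ (by linear_combination -e)
  have : x - b = ((x₁ - b) - k * (x₃ - b)) / (1 - k) := by
    rw [eq_div_iff hk1]
    linear_combination e
  rw [this]
  exact div_mem (sub_mem b₁ (mul_mem hk b₃)) (sub_mem (one_mem G) hk)

/-- A strong antifield meets every Möbius preimage of a subfield in few points. -/
lemma IsStrongAntifield₁.ncard_moebius_le [Finite F] {lam : ℝ} {A : Set F}
    (hA : IsStrongAntifield₁ lam A) (G : Subfield F) {α β γ δ : F}
    (hdet : α * δ - β * γ ≠ 0) :
    (({x | x ∈ A ∧ γ * x + δ ≠ 0 ∧ (α * x + β) / (γ * x + δ) ∈ G} : Set F).ncard : ℝ)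
      ≤ max lam ((Nat.card G : ℝ) ^ (1 / 2 : ℝ)) := by
  classical
  set C : Set F := {x | x ∈ A ∧ γ * x + δ ≠ 0 ∧ (α * x + β) / (γ * x + δ) ∈ G} with hC
  -- The translate condition covers only `|G| ≥ lam`; for smaller `G`, injectivity of the Möbius map
  -- suffices.
  rcases lt_or_ge (Nat.card G : ℝ) lam with hlt | hge
  · refine le_max_of_le_left (le_trans ?_ hlt.le)
    have : C.ncard ≤ (G : Set F).ncard := by
      refine Set.ncard_le_ncard_of_injOn (fun x => (α * x + β) / (γ * x + δ))
        (fun x hx => hx.2.2) ?_ (Set.toFinite _)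
      intro x hx y hy hxy
      have hx' := hx.2.1
      have hy' := hy.2.1
      simp only at hxy
      rw [div_eq_div_iff hx' hy'] at hxy
      have : (α * δ - β * γ) * (x - y) = 0 := by linear_combination hxy
      exact sub_eq_zero.1 ((mul_eq_zero.1 this).resolve_left hdet)
    have hcard : (G : Set F).ncard = Nat.card G := (Nat.card_coe_set_eq _).symm
    rw [hcard] at this
    exact_mod_cast this
  · by_cases hthree : ∃ b x₁ x₂ x₃ : F, x₁ ∈ C ∧ x₂ ∈ C ∧ x₃ ∈ C ∧ x₁ ≠ x₂ ∧ x₁ ≠ x₃ ∧ x₂ ≠ x₃ ∧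
        x₁ - b ∈ G ∧ x₂ - b ∈ G ∧ x₃ - b ∈ G
    · obtain ⟨b, x₁, x₂, x₃, c₁, c₂, c₃, h₁₂, h₁₃, h₂₃, b₁, b₂, b₃⟩ := hthree
      refine le_trans ?_ (hA.1 G 1 b)
      have : C ⊆ A ∩ (fun g : F => 1 * g + b) '' (G : Set F) := by
        intro x hx
        refine ⟨hx.1, x - b, ?_, by ring⟩
        exact sub_mem_of_moebius_mem G hdet c₁.2.1 c₂.2.1 c₃.2.1 hx.2.1 c₁.2.2 c₂.2.2 c₃.2.2 hx.2.2
          h₁₂ h₁₃ h₂₃ b₁ b₂ b₃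
      exact_mod_cast Set.ncard_le_ncard this (Set.toFinite _)
    -- No translate holds three points of `C`. The resulting factor 2 cancels the `1/2` in the bound
    -- on translates.
    · have hfin : C.Finite := Set.toFinite _
      have hfin' : (translatesMeeting G A).Finite := Set.toFinite _
      have hle : hfin.toFinset.card ≤ 2 * hfin'.toFinset.card := by
        refine Finset.card_le_mul_card_image_of_maps_to
          (f := fun x => (fun g : F => g + x) '' (G : Set F)) ?_ 2 ?_
        · intro x hx
          have hx : x ∈ C := by simpa using hx
          simp only [Set.Finite.mem_toFinset]
          exact ⟨⟨x, rfl⟩, x, hx.1, 0, G.zero_mem, by simp⟩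
        · intro S _
          by_contra hcon
          push Not at hcon
          obtain ⟨x₁, m₁, x₂, m₂, x₃, m₃, h₁₂, h₁₃, h₂₃⟩ := Finset.two_lt_card.1 hcon
          simp only [Finset.mem_filter, Set.Finite.mem_toFinset] at m₁ m₂ m₃
          have aux : ∀ y ∈ C, (fun g : F => g + y) '' (G : Set F) = S → y - x₁ ∈ G := by
            intro y _ hy
            have : y ∈ (fun g : F => g + x₁) '' (G : Set F) := by
              rw [m₁.2, ← hy]
              exact ⟨0, G.zero_mem, by simp⟩
            obtain ⟨g, hg, hgy⟩ := this
            rw [← hgy]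
            simpa using hg
          exact hthree ⟨x₁, x₁, x₂, x₃, m₁.1, m₂.1, m₃.1, h₁₂, h₁₃, h₂₃,
            aux _ m₁.1 m₁.2, aux _ m₂.1 m₂.2, aux _ m₃.1 m₃.2⟩
      rw [← Set.ncard_eq_toFinset_card _ hfin, ← Set.ncard_eq_toFinset_card _ hfin'] at hle
      have h2 := hA.2 G hge
      have h3 : (C.ncard : ℝ) ≤ 2 * ((translatesMeeting G A).ncard : ℝ) := by exact_mod_cast hle
      linarith

end MoebiusImages

/-! ### Dilations that barely expand a set, and the subfields they generate. -/

section DilateGrowth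

open Finset
open scoped Pointwise

/-- Cauchy–Schwarz for the number of collisions of a map from `s` to `t`. -/
lemma card_sq_le_card_mul_card_collisions {ι κ : Type*} [DecidableEq κ] (s : Finset ι)
    (t : Finset κ) (f : ι → κ) (hf : ∀ x ∈ s, f x ∈ t) :
    #s ^ 2 ≤ #t * #{p ∈ s ×ˢ s | f p.1 = f p.2} := by
  have h1 : #s = ∑ b ∈ t, #{a ∈ s | f a = b} := card_eq_sum_card_fiberwise hf
  have h2 : #{p ∈ s ×ˢ s | f p.1 = f p.2} = ∑ b ∈ t, #{a ∈ s | f a = b} ^ 2 := by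
    rw [card_eq_sum_card_fiberwise (f := fun p : ι × ι => f p.1) (t := t)]
    · refine sum_congr rfl fun b _ => ?_
      rw [sq, ← card_product]
      congr 1
      ext p
      simp only [mem_filter, mem_product]
      constructor
      · rintro ⟨⟨⟨h1, h2⟩, h3⟩, h4⟩
        exact ⟨⟨h1, h4⟩, h2, h3 ▸ h4⟩
      · rintro ⟨⟨h1, h2⟩, h3, h4⟩
        exact ⟨⟨⟨h1, h3⟩, h2.trans h4.symm⟩, h2⟩
    · intro p hp
      simp only [coe_filter, mem_product, Set.mem_ofPred_eq] at hp
      exact hf _ hp.1.1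
  rw [h2, h1]
  exact sq_sum_le_card_mul_sum_sq

variable {F : Type*} [Field F] [DecidableEq F]

/-- Ruzsa's triangle inequality in its metric form. -/
lemma card_sub_mul_card_le (A B C : Finset F) : #(A - C) * #B ≤ #(A - B) * #(B - C) := by
  have := ruzsa_triangle_inequality_sub_sub_sub A B C
  rwa [← card_neg (C - B), neg_sub] at this

lemma smul_finset_sub_eq (u : F) (A B : Finset F) : u • (A - B) = u • A - u • B :=
  image_image₂_distrib (smul_sub u)

/-- The dilate of `V` by `u` has difference set with `V` of size at most `κ |V|`. -/
def DilateBounded (V : Finset F) (κ : ℝ) (u : F) : Prop := (#(V - u • V) : ℝ) ≤ κ * #V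

variable {V : Finset F} {κ κ' σ τ : ℝ} {u u' : F}

lemma DilateBounded.mono (h : DilateBounded V κ u) (hκ : κ ≤ κ') : DilateBounded V κ' u :=
  h.trans (by gcongr)

lemma dilateBounded_zero (hκ : 1 ≤ κ) : DilateBounded V κ (0 : F) := by
  unfold DilateBounded
  rcases V.eq_empty_or_nonempty with rfl | hV
  · simp
  · rw [zero_smul_finset hV]
    simp only [sub_zero]
    nlinarith [(Nat.cast_nonneg #V : (0 : ℝ) ≤ #V)]

/-- Ruzsa's triangle inequality through `u • V`, since `u • V - (u * u') • V` is a dilate of `V - u'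
• V`. Dilation by zero collapses `V` and is treated apart. -/
lemma DilateBounded.mul (hκ : 1 ≤ κ) (hκ' : 1 ≤ κ') (h : DilateBounded V κ u)
    (h' : DilateBounded V κ' u') : DilateBounded V (κ * κ') (u * u') := by
  rcases V.eq_empty_or_nonempty with rfl | hV
  · simp [DilateBounded]
  by_cases hu : u = 0
  · subst hu
    rw [zero_mul]
    exact dilateBounded_zero (one_le_mul_of_one_le_of_one_le hκ hκ')
  unfold DilateBounded at *
  have hpos : (0 : ℝ) < #V := by exact_mod_cast hV.card_pos
  have h1 := card_sub_mul_card_le V (u • V) ((u * u') • V)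
  rw [mul_smul, ← smul_finset_sub_eq, card_smul_finset₀ hu, card_smul_finset₀ hu] at h1
  have h2 : (#(V - u • u' • V) : ℝ) * #V ≤ #(V - u • V) * #(V - u' • V) := by exact_mod_cast h1
  rw [mul_smul]
  refine le_of_mul_le_mul_right (h2.trans ?_) hpos
  calc (#(V - u • V) : ℝ) * #(V - u' • V) ≤ (κ * #V) * (κ' * #V) := by gcongr
    _ = κ * κ' * #V * #V := by ring

lemma DilateBounded.inv (hu : u ≠ 0) (h : DilateBounded V κ u) : DilateBounded V κ u⁻¹ := by
  unfold DilateBounded at *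
  have : #(V - u⁻¹ • V) = #(V - u • V) := by
    rw [← card_smul_finset₀ hu (V - u⁻¹ • V), smul_finset_sub_eq, smul_inv_smul₀ hu, ← card_neg,
      neg_sub]
  rwa [this]

/-- The sum lies in `Z + Z' + (3V - 2V)`, and Plünnecke–Ruzsa bounds `3V - 2V` by `σ ^ 5 * #V`. -/
lemma card_add_add_le_of_covered (hV : V.Nonempty) (hσ : (#(V - V) : ℝ) ≤ σ * #V)
    {A A' Z Z' : Finset F} (hA : A ⊆ Z + (V - V)) (hA' : A' ⊆ Z' + (V - V)) :
    (#(V + A + A') : ℝ) ≤ #Z * #Z' * (σ ^ 5 * #V) := by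
  have hpos : (0 : ℝ) < #V := by exact_mod_cast hV.card_pos
  have e : V + (Z + (V - V)) + (Z' + (V - V)) = Z + Z' + (3 • V - 2 • V) := by
    simp only [succ_nsmul, zero_nsmul, zero_add, sub_eq_add_neg, neg_add_rev]
    ac_rfl
  have h1 : #(V + A + A') ≤ #Z * #Z' * #(3 • V - 2 • V) := by
    calc #(V + A + A') ≤ #(V + (Z + (V - V)) + (Z' + (V - V))) := by
          apply card_le_card
          gcongr
      _ = #(Z + Z' + (3 • V - 2 • V)) := by rw [e]
      _ ≤ #(Z + Z') * #(3 • V - 2 • V) := card_add_le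
      _ ≤ _ := by gcongr; exact card_add_le
  have h2 : (#(3 • V - 2 • V) : ℝ) ≤ σ ^ 5 * #V := by
    have h3 := pluennecke_ruzsa_inequality_nsmul_sub_nsmul_sub hV V 3 2
    have h4 : (#(3 • V - 2 • V) : ℝ) ≤ ((#(V - V) : ℝ) / #V) ^ (3 + 2) * #V := by
      have h5 := (NNRat.cast_le (K := ℝ)).2 h3
      push_cast at h5
      exact h5
    refine h4.trans ?_
    gcongr
    rwa [div_le_iff₀ hpos]
  calc (#(V + A + A') : ℝ) ≤ #Z * #Z' * #(3 • V - 2 • V) := by exact_mod_cast h1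
    _ ≤ _ := by gcongr

lemma DilateBounded.exists_cover (hV : V.Nonempty) (h : DilateBounded V κ u) :
    ∃ Z : Finset F, (#Z : ℝ) ≤ κ ∧ -(u • V) ⊆ Z + (V - V) := by
  obtain ⟨Z, -, h1, h2⟩ := ruzsa_covering_add (A := -(u • V)) (K := κ) hV (by
    rw [add_comm, ← sub_eq_add_neg]; exact h)
  exact ⟨Z, h1, h2⟩

/-- `V - (u + u') • V` is contained in `V - u • V - u' • V`. Ruzsa covering replaces the two dilates
by at most `κ` and `κ'` translates of `V - V`. -/
lemma DilateBounded.add (hσ1 : DilateBounded V σ 1) (h : DilateBounded V κ u)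
    (h' : DilateBounded V κ' u') : DilateBounded V (κ * κ' * σ ^ 5) (u + u') := by
  rcases V.eq_empty_or_nonempty with rfl | hV
  · simp [DilateBounded]
  have hσ : (#(V - V) : ℝ) ≤ σ * #V := by simpa [DilateBounded] using hσ1
  obtain ⟨Z, hZ, hc⟩ := h.exists_cover hV
  obtain ⟨Z', hZ', hc'⟩ := h'.exists_cover hV
  have hsub : V - (u + u') • V ⊆ V + -(u • V) + -(u' • V) := by
    intro x hx
    obtain ⟨a, ha, b, hb, rfl⟩ := mem_sub.1 hx
    obtain ⟨v, hv, rfl⟩ := mem_smul_finset.1 hb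
    refine mem_add.2 ⟨a + -(u * v), mem_add.2 ⟨a, ha, _, neg_mem_neg (smul_mem_smul_finset hv),
      rfl⟩, -(u' * v), neg_mem_neg (smul_mem_smul_finset hv), ?_⟩
    simp only [smul_eq_mul]
    ring
  have hpos : (0 : ℝ) < #V := by exact_mod_cast hV.card_pos
  have hσ0 : 0 ≤ σ := by
    by_contra hneg
    push Not at hneg
    nlinarith [(Nat.cast_nonneg #(V - V) : (0 : ℝ) ≤ #(V - V))]
  calc (#(V - (u + u') • V) : ℝ) ≤ #(V + -(u • V) + -(u' • V)) := by
        exact_mod_cast card_le_card hsub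
    _ ≤ #Z * #Z' * (σ ^ 5 * #V) := card_add_add_le_of_covered hV hσ hc hc'
    _ ≤ κ * κ' * (σ ^ 5 * #V) := by
        gcongr
        exact (Nat.cast_nonneg _).trans hZ
    _ = _ := by ring

lemma DilateBounded.sub (hσ1 : DilateBounded V σ 1) (h : DilateBounded V κ u)
    (h' : DilateBounded V κ' u') : DilateBounded V (κ * κ' * σ ^ 5) (u - u') := by
  rcases V.eq_empty_or_nonempty with rfl | hV
  · simp [DilateBounded]
  have hσ : (#(V - V) : ℝ) ≤ σ * #V := by simpa [DilateBounded] using hσ1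
  obtain ⟨Z, hZ, hc⟩ := h.exists_cover hV
  obtain ⟨Z', hZ', hc'⟩ := h'.exists_cover hV
  -- `V - V` is symmetric, so a covering of `-(u' • V)` also covers `u' • V` after negating the
  -- centres.
  have hc'' : u' • V ⊆ -Z' + (V - V) := by
    have := neg_subset_neg hc'
    rwa [neg_neg, neg_add, neg_sub] at this
  have hsub : V - (u - u') • V ⊆ V + -(u • V) + u' • V := by
    intro x hx
    obtain ⟨a, ha, b, hb, rfl⟩ := mem_sub.1 hx
    obtain ⟨v, hv, rfl⟩ := mem_smul_finset.1 hb
    refine mem_add.2 ⟨a + -(u * v), mem_add.2 ⟨a, ha, _, neg_mem_neg (smul_mem_smul_finset hv),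
      rfl⟩, u' * v, smul_mem_smul_finset hv, ?_⟩
    simp only [smul_eq_mul]
    ring
  have hpos : (0 : ℝ) < #V := by exact_mod_cast hV.card_pos
  have hσ0 : 0 ≤ σ := by
    by_contra hneg
    push Not at hneg
    nlinarith [(Nat.cast_nonneg #(V - V) : (0 : ℝ) ≤ #(V - V))]
  calc (#(V - (u - u') • V) : ℝ) ≤ #(V + -(u • V) + u' • V) := by
        exact_mod_cast card_le_card hsub
    _ ≤ #Z * #(-Z') * (σ ^ 5 * #V) := card_add_add_le_of_covered hV hσ hc hc''
    _ ≤ κ * κ' * (σ ^ 5 * #V) := by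
        rw [card_neg]
        gcongr
        exact (Nat.cast_nonneg _).trans hZ
    _ = _ := by ring

/-- Few dilates of a large set have a small difference set with it. -/
lemma card_dilateBounded_le (hκ : 1 ≤ κ) (hV : 2 * κ ≤ #V) (U : Finset F)
    (hU : ∀ u ∈ U, DilateBounded V κ u) : (#U : ℝ) ≤ 2 * κ * #V := by
  set W := V ×ˢ V
  have hpos : (0 : ℝ) < #V := by linarith
  -- Double counting of solutions of `v₁ - u v₂ = v₃ - u v₄`: each `u` has at least `|V|^3 / κ`. A
  -- nontrivial quadruple determines `u`, and the trivial ones are absorbed using `|V| ≥ 2κ`.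
  have h1 : ∀ u ∈ U, (#V : ℝ) ^ 3 ≤
      κ * #{p ∈ W ×ˢ W | p.1.1 - u * p.1.2 = p.2.1 - u * p.2.2} := by
    intro u hu
    have h := card_sq_le_card_mul_card_collisions W (V - u • V) (fun p => p.1 - u * p.2) (by
      intro p hp
      rw [mem_product] at hp
      exact sub_mem_sub hp.1 (smul_mem_smul_finset hp.2))
    set E := #{p ∈ W ×ˢ W | p.1.1 - u * p.1.2 = p.2.1 - u * p.2.2}
    have h' : ((#V : ℝ) * #V) ^ 2 ≤ #(V - u • V) * E := by
      rw [card_product] at h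
      exact_mod_cast h
    have h2 : (#(V - u • V) : ℝ) * E ≤ (κ * #V) * E := by
      gcongr
      exact hU u hu
    refine le_of_mul_le_mul_right ?_ hpos
    nlinarith
  have h2 : ∑ u ∈ U, #{p ∈ W ×ˢ W | p.1.1 - u * p.1.2 = p.2.1 - u * p.2.2}
      ≤ #V ^ 4 + #V ^ 2 * #U := by
    simp_rw [card_filter]
    rw [sum_comm]
    have h3 : ∀ p ∈ W ×ˢ W, (∑ u ∈ U, if p.1.1 - u * p.1.2 = p.2.1 - u * p.2.2 then 1 else 0)
        ≤ 1 + if p.1 = p.2 then #U else 0 := by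
      intro p _
      rw [← card_filter]
      split_ifs with hp
      · exact (card_filter_le _ _).trans (by omega)
      · refine card_le_one.2 fun a ha b hb => ?_
        simp only [mem_filter] at ha hb
        by_cases h22 : p.1.2 = p.2.2
        · exfalso
          apply hp
          refine Prod.ext ?_ h22
          have := ha.2
          rw [h22] at this
          linear_combination this
        · have : (a - b) * (p.1.2 - p.2.2) = 0 := by linear_combination hb.2 - ha.2
          exact sub_eq_zero.1 ((mul_eq_zero.1 this).resolve_right (sub_ne_zero.2 h22))
    refine (sum_le_sum h3).trans ?_
    rw [sum_add_distrib, sum_const, ← sum_filter, sum_const]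
    have h4 : #{p ∈ W ×ˢ W | p.1 = p.2} ≤ #W := by
      refine card_le_card_of_injOn Prod.fst ?_ ?_
      · intro p hp
        simp only [coe_filter, mem_product, Set.mem_ofPred_eq] at hp
        exact hp.1.1
      · intro p hp q hq hpq
        simp only [coe_filter, Set.mem_ofPred_eq] at hp hq
        exact Prod.ext hpq (by rw [← hp.2, ← hq.2, hpq])
    have hW : #W = #V ^ 2 := by rw [card_product, sq]
    simp only [smul_eq_mul, mul_one, card_product, hW] at *
    nlinarith
  have h3 : (#U : ℝ) * #V ^ 3 ≤ κ * (#V ^ 4 + #V ^ 2 * #U) := by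
    calc (#U : ℝ) * #V ^ 3 = ∑ u ∈ U, (#V : ℝ) ^ 3 := by rw [sum_const, nsmul_eq_mul]
      _ ≤ ∑ u ∈ U, κ * #{p ∈ W ×ˢ W | p.1.1 - u * p.1.2 = p.2.1 - u * p.2.2} := sum_le_sum h1
      _ = κ * ∑ u ∈ U, (#{p ∈ W ×ˢ W | p.1.1 - u * p.1.2 = p.2.1 - u * p.2.2} : ℝ) := by
          rw [mul_sum]
      _ ≤ κ * (#V ^ 4 + #V ^ 2 * #U) := by gcongr; exact_mod_cast h2
  have h4 : (#U : ℝ) * #V ≤ κ * #V ^ 2 + κ * #U := by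
    refine le_of_mul_le_mul_right ?_ (by positivity : (0 : ℝ) < #V ^ 2)
    nlinarith
  have h5 : 2 * κ * (#U : ℝ) ≤ #V * #U := by gcongr
  refine le_of_mul_le_mul_right ?_ hpos
  nlinarith

/-- If a set `T` of dilations barely expands a set `V`, while `T` is not much smaller than `V`, then
`T` lies in an affine image of a subfield that is not much larger than `V`. -/
theorem exists_subfield_of_dilateBounded (T : Finset F) (hσ : 1 ≤ σ) (hτ : 1 ≤ τ)
    (hσ1 : DilateBounded V σ 1) (hT : ∀ t ∈ T, DilateBounded V τ t)
    (hV : 2 * (τ ^ 10 * σ ^ 30) ≤ #V) (hTV : 2 * (τ ^ 10 * σ ^ 30) * #V < (#T : ℝ) ^ 2) :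
    ∃ G : Subfield F, (Nat.card G : ℝ) ≤ 2 * (τ ^ 10 * σ ^ 30) * #V ∧
      ∃ a b : F, a ≠ 0 ∧ ∀ t ∈ T, (t - b) / a ∈ G := by
  -- Differences of elements of `T` cost `μ = τ² σ^5`, quotients of these cost `μ²`, and a sum of
  -- two quotients costs `μ^4 σ^5`. Multiplying by `f ∈ T` and adding `t ∈ T` brings another `τ²
  -- σ^5`, which totals `τ^10 σ^30`.
  set κ := τ ^ 10 * σ ^ 30 with hκdef
  have hκ : 1 ≤ κ := one_le_mul_of_one_le_of_one_le (one_le_pow₀ hτ) (one_le_pow₀ hσ)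
  have hT2 : 1 < #T := by
    have : (1 : ℝ) < (#T : ℝ) ^ 2 := by nlinarith
    by_contra h
    push Not at h
    have h' : (#T : ℝ) ≤ 1 := by exact_mod_cast h
    nlinarith [(Nat.cast_nonneg #T : (0 : ℝ) ≤ #T)]
  obtain ⟨t₀, ht₀, t₁, ht₁, ht⟩ := one_lt_card.1 hT2
  set μ := τ * τ * σ ^ 5 with hμ
  have hμ1 : 1 ≤ μ := one_le_mul_of_one_le_of_one_le
    (one_le_mul_of_one_le_of_one_le hτ hτ) (one_le_pow₀ hσ)
  set R : Finset F :=
    ((T ×ˢ T) ×ˢ {p ∈ T ×ˢ T | p.1 ≠ p.2}).image fun q => (q.1.1 - q.1.2) / (q.2.1 - q.2.2) with hR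
  have memR : ∀ x, x ∈ R ↔ ∃ a ∈ T, ∃ b ∈ T, ∃ c ∈ T, ∃ d ∈ T, c ≠ d ∧
      (a - b) / (c - d) = x := by
    intro x
    simp only [hR, mem_image, mem_product, mem_filter, Prod.exists]
    constructor
    · rintro ⟨a, b, c, d, ⟨⟨ha, hb⟩, ⟨hc, hd⟩, hcd⟩, rfl⟩
      exact ⟨a, ha, b, hb, c, hc, d, hd, hcd, rfl⟩
    · rintro ⟨a, ha, b, hb, c, hc, d, hd, hcd, rfl⟩
      exact ⟨a, b, c, d, ⟨⟨ha, hb⟩, ⟨hc, hd⟩, hcd⟩, rfl⟩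
  have hdiff : ∀ a ∈ T, ∀ b ∈ T, DilateBounded V μ (a - b) := fun a ha b hb =>
    hσ1.sub (hT a ha) (hT b hb)
  have hRb : ∀ x ∈ R, DilateBounded V (μ * μ) x := by
    intro x hx
    obtain ⟨a, ha, b, hb, c, hc, d, hd, hcd, rfl⟩ := (memR x).1 hx
    rw [div_eq_mul_inv]
    exact (hdiff a ha b hb).mul hμ1 hμ1 ((hdiff c hc d hd).inv (sub_ne_zero.2 hcd))
  have hμμ : 1 ≤ μ * μ := one_le_mul_of_one_le_of_one_le hμ1 hμ1
  -- The pivot: if `u` is not a quotient of differences of `T`, the elements `u * f + t` are all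
  -- distinct. That gives `|T|^2` good dilations, more than `V` admits.
  have closed : ∀ u, (∀ t ∈ T, ∀ f ∈ T, DilateBounded V κ (u * f + t)) → u ∈ R := by
    intro u hu
    by_contra hcon
    have hinj : Set.InjOn (fun p : F × F => u * p.1 + p.2) (T ×ˢ T : Finset (F × F)) := by
      intro p hp q hq hpq
      simp only [coe_product, Set.mem_prod, mem_coe] at hp hq hpq
      by_cases h : p.1 = q.1
      · refine Prod.ext h ?_
        rw [h] at hpq
        exact add_left_cancel hpq
      · exfalso
        apply hcon
        refine (memR u).2 ⟨q.2, hq.2, p.2, hp.2, p.1, hp.1, q.1, hq.1, h, ?_⟩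
        rw [div_eq_iff (sub_ne_zero.2 h)]
        linear_combination -hpq
    have hle := card_dilateBounded_le hκ hV ((T ×ˢ T).image fun p : F × F => u * p.1 + p.2) (by
      intro x hx
      obtain ⟨p, hp, rfl⟩ := mem_image.1 hx
      rw [mem_product] at hp
      exact hu _ hp.2 _ hp.1)
    rw [card_image_of_injOn hinj, card_product] at hle
    push_cast at hle
    nlinarith
  have zero_mem : (0 : F) ∈ R :=
    (memR 0).2 ⟨t₀, ht₀, t₀, ht₀, t₀, ht₀, t₁, ht₁, ht, by simp⟩
  have one_mem : (1 : F) ∈ R :=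
    (memR 1).2 ⟨t₀, ht₀, t₁, ht₁, t₀, ht₀, t₁, ht₁, ht, div_self (sub_ne_zero.2 ht)⟩
  have add_mem : ∀ x y, x ∈ R → y ∈ R → x + y ∈ R := by
    intro x y hx hy
    refine closed _ fun t ht f hf => ?_
    have h1 := hσ1.add (hRb x hx) (hRb y hy)
    have h1' : 1 ≤ μ * μ * (μ * μ) * σ ^ 5 := one_le_mul_of_one_le_of_one_le
      (one_le_mul_of_one_le_of_one_le hμμ hμμ) (one_le_pow₀ hσ)
    refine (hσ1.add (h1.mul h1' hτ (hT f hf)) (hT t ht)).mono (le_of_eq ?_)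
    rw [hκdef, hμ]
    ring
  have mul_mem : ∀ x y, x ∈ R → y ∈ R → x * y ∈ R := by
    intro x y hx hy
    refine closed _ fun t ht f hf => ?_
    have h1 := (hRb x hx).mul hμμ hμμ (hRb y hy)
    have h1' : 1 ≤ μ * μ * (μ * μ) := one_le_mul_of_one_le_of_one_le hμμ hμμ
    refine (hσ1.add (h1.mul h1' hτ (hT f hf)) (hT t ht)).mono ?_
    have : κ = μ * μ * (μ * μ) * τ * τ * σ ^ 5 * σ ^ 5 := by
      rw [hκdef, hμ]
      ring
    rw [this]
    refine le_mul_of_one_le_right (by positivity) (one_le_pow₀ hσ)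
  have neg_mem : ∀ x, x ∈ R → -x ∈ R := by
    intro x hx
    obtain ⟨a, ha, b, hb, c, hc, d, hd, hcd, rfl⟩ := (memR x).1 hx
    exact (memR _).2 ⟨b, hb, a, ha, c, hc, d, hd, hcd, by rw [← neg_div, neg_sub]⟩
  have inv_mem : ∀ x, x ∈ R → x⁻¹ ∈ R := by
    intro x hx
    obtain ⟨a, ha, b, hb, c, hc, d, hd, hcd, rfl⟩ := (memR x).1 hx
    by_cases hab : a = b
    -- A zero quotient has inverse `0` by convention.
    · simpa [hab] using zero_mem
    · exact (memR _).2 ⟨c, hc, d, hd, a, ha, b, hb, hab, by rw [inv_div]⟩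
  let G : Subfield F :=
    { carrier := R
      mul_mem' := fun {x y} hx hy => mul_mem x y hx hy
      one_mem' := one_mem
      add_mem' := fun {x y} hx hy => add_mem x y hx hy
      zero_mem' := zero_mem
      neg_mem' := fun {x} hx => neg_mem x hx
      inv_mem' := fun x hx => inv_mem x hx }
  refine ⟨G, ?_, t₁ - t₀, t₀, sub_ne_zero.2 ht.symm, fun t htT => ?_⟩
  · have hcard : Nat.card G = #R := by
      change Nat.card (R : Set F) = _
      simp
    rw [hcard]
    refine card_dilateBounded_le hκ hV R fun x hx => (hRb x hx).mono ?_
    have : κ = μ * μ * (τ ^ 6 * σ ^ 20) := by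
      rw [hκdef, hμ]
      ring
    rw [this]
    exact le_mul_of_one_le_right (by positivity)
      (one_le_mul_of_one_le_of_one_le (one_le_pow₀ hτ) (one_le_pow₀ hσ))
  · exact (memR _).2 ⟨t, htT, t₀, ht₀, t₁, ht₁, t₀, ht₀, ht.symm, rfl⟩

end DilateGrowth

/-! ### Paths of length three and the Balog–Szemerédi–Gowers argument. -/

section BalogSzemerediGowers

open Finset
open scoped Pointwise

/-- In a dense bipartite graph some neighbourhood `X₂` is large and has few pairs of vertices with
few common neighbours. -/
lemma exists_subset_few_bad_pairs {α β : Type*} [DecidableEq α] [DecidableEq β]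
    (X : Finset α) (Y : Finset β) (E : Finset (α × β)) {b c ε : ℝ} {N : ℕ}
    (hX : #X ≤ N) (hY : Y.Nonempty) (hN : 0 < N) (hb : 0 < b) (hε : 0 < ε) (hc : 2 * c = ε * b ^ 2)
    (hE : b * (N * #Y) ≤ #{p ∈ X ×ˢ Y | p ∈ E}) :
    ∃ X₂ ⊆ X, b * N ≤ (3 / 2 : ℝ) * #X₂ ∧
      (#{q ∈ X₂ ×ˢ X₂ | (#{y ∈ Y | (q.1, y) ∈ E ∧ (q.2, y) ∈ E} : ℝ) < c * #Y} : ℝ)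
        ≤ ε * #X₂ ^ 2 := by
  set nb : β → Finset α := fun y => {x ∈ X | (x, y) ∈ E} with hnb
  set co : α × α → ℝ := fun q => (#{y ∈ Y | (q.1, y) ∈ E ∧ (q.2, y) ∈ E} : ℝ) with hco
  set bad : β → Finset (α × α) := fun y => {q ∈ nb y ×ˢ nb y | co q < c * #Y} with hbad
  have hYpos : (0 : ℝ) < #Y := by exact_mod_cast hY.card_pos
  have hNpos : (0 : ℝ) < N := by exact_mod_cast hN
  have hcpos : 0 < c := by nlinarith [mul_pos hε (pow_pos hb 2)]
  have hsum : b * (N * #Y) ≤ ∑ y ∈ Y, (#(nb y) : ℝ) := by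
    refine hE.trans (le_of_eq ?_)
    rw [card_filter, sum_product_right]
    push_cast
    refine sum_congr rfl fun y _ => ?_
    rw [hnb, card_filter]
    push_cast
    rfl
  have hsq : b ^ 2 * N ^ 2 * #Y ≤ ∑ y ∈ Y, (#(nb y) : ℝ) ^ 2 := by
    have h1 := sq_sum_le_card_mul_sum_sq (s := Y) (f := fun y => (#(nb y) : ℝ))
    have h2 : (b * (N * #Y)) ^ 2 ≤ (∑ y ∈ Y, (#(nb y) : ℝ)) ^ 2 := by gcongr
    refine le_of_mul_le_mul_left ?_ hYpos
    nlinarith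
  have hbadsum : ∑ y ∈ Y, (#(bad y) : ℝ) ≤ N ^ 2 * (c * #Y) := by
    have h1 : ∑ y ∈ Y, (#(bad y) : ℝ) = ∑ q ∈ {q ∈ X ×ˢ X | co q < c * #Y}, co q := by
      have h2 : ∀ y ∈ Y, (#(bad y) : ℝ) = ∑ q ∈ {q ∈ X ×ˢ X | co q < c * #Y},
          if (q.1, y) ∈ E ∧ (q.2, y) ∈ E then (1 : ℝ) else 0 := by
        intro y _
        rw [← sum_filter, sum_const, nsmul_eq_mul, mul_one]
        congr 2
        ext q
        simp only [hbad, hnb, mem_filter, mem_product]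
        tauto
      rw [sum_congr rfl h2, sum_comm]
      refine sum_congr rfl fun q _ => ?_
      rw [hco, ← sum_filter, sum_const, nsmul_eq_mul, mul_one]
    rw [h1]
    calc ∑ q ∈ {q ∈ X ×ˢ X | co q < c * #Y}, co q
        ≤ ∑ q ∈ {q ∈ X ×ˢ X | co q < c * #Y}, c * #Y :=
          sum_le_sum fun q hq => (mem_filter.1 hq).2.le
      _ = #{q ∈ X ×ˢ X | co q < c * #Y} * (c * #Y) := by rw [sum_const, nsmul_eq_mul]
      _ ≤ N ^ 2 * (c * #Y) := by
          gcongr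
          have := (card_filter_le (X ×ˢ X) fun q => co q < c * #Y)
          rw [card_product] at this
          have h3 : #X * #X ≤ N ^ 2 := by nlinarith
          exact_mod_cast this.trans h3
  -- Dependent choice: a pair with few common neighbours survives in few neighbourhoods. One average
  -- of this difference yields a neighbourhood that is both large and poor in bad pairs.
  obtain ⟨y, hy, hyle⟩ : ∃ y ∈ Y, b ^ 2 * N ^ 2 / 2 ≤ (#(nb y) : ℝ) ^ 2 - #(bad y) / ε := by
    refine exists_le_of_sum_le hY ?_
    rw [sum_const, nsmul_eq_mul, sum_sub_distrib, ← sum_div]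
    have : (∑ y ∈ Y, (#(bad y) : ℝ)) / ε ≤ N ^ 2 * #Y * (b ^ 2 / 2) := by
      rw [div_le_iff₀ hε]
      refine hbadsum.trans (le_of_eq ?_)
      rw [show c = ε * b ^ 2 / 2 by linarith]
      ring
    nlinarith
  refine ⟨nb y, filter_subset _ _, ?_, ?_⟩
  · have h0 : 0 ≤ (#(bad y) : ℝ) / ε := by positivity
    have h1 : (b * N) ^ 2 ≤ ((3 / 2 : ℝ) * #(nb y)) ^ 2 := by nlinarith
    exact (pow_le_pow_iff_left₀ (by positivity) (by positivity) two_ne_zero).1 h1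
  · have h0 : 0 ≤ b ^ 2 * (N : ℝ) ^ 2 / 2 := by positivity
    have h1 : (#(bad y) : ℝ) / ε ≤ (#(nb y) : ℝ) ^ 2 := by linarith
    rw [div_le_iff₀ hε] at h1
    linarith

/-- A dense bipartite graph contains large vertex sets all of whose pairs are joined by many paths
of length three. -/
lemma exists_many_paths_of_length_three {α β : Type*} [DecidableEq α] [DecidableEq β]
    (X : Finset α) (Y : Finset β) (E : Finset (α × β)) {h : ℝ} (hh : 0 < h)
    (hX : X.Nonempty) (hY : Y.Nonempty) (hE : E ⊆ X ×ˢ Y) (hcard : h * (#X * #Y) ≤ #E) :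
    ∃ X' ⊆ X, ∃ Y' ⊆ Y, h * #X ≤ 8 * #X' ∧ h * #Y ≤ 8 * #Y' ∧
      ∀ x ∈ X', ∀ y ∈ Y', h ^ 5 * (#X * #Y) ≤
        4096 * #{p ∈ X ×ˢ Y | (x, p.2) ∈ E ∧ p ∈ E ∧ (p.1, y) ∈ E} := by
  have hXpos : (0 : ℝ) < #X := by exact_mod_cast hX.card_pos
  have hYpos : (0 : ℝ) < #Y := by exact_mod_cast hY.card_pos
  -- Removing low degrees first ensures that any subset `X₂` still sends many edges to `Y`, as is
  -- needed for `Y'` to be large.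
  set X₁ : Finset α := {x ∈ X | h * #Y ≤ 2 * (#{y ∈ Y | (x, y) ∈ E} : ℝ)} with hX₁
  have hX₁sub : X₁ ⊆ X := filter_subset _ _
  have hdense : h / 2 * (#X * #Y) ≤ #{p ∈ X₁ ×ˢ Y | p ∈ E} := by
    have e1 : (#E : ℝ) = ∑ x ∈ X, (#{y ∈ Y | (x, y) ∈ E} : ℝ) := by
      have : E = {p ∈ X ×ˢ Y | p ∈ E} := by
        ext p
        simp only [mem_filter]
        exact ⟨fun hp => ⟨hE hp, hp⟩, fun hp => hp.2⟩
      rw [this, card_filter, sum_product]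
      push_cast
      refine sum_congr rfl fun x hx => ?_
      rw [card_filter]
      push_cast
      refine sum_congr rfl fun y hy => ?_
      simp [hx, hy]
    have e2 : (#{p ∈ X₁ ×ˢ Y | p ∈ E} : ℝ) = ∑ x ∈ X₁, (#{y ∈ Y | (x, y) ∈ E} : ℝ) := by
      rw [card_filter, sum_product]
      push_cast
      refine sum_congr rfl fun x _ => ?_
      rw [card_filter]
      push_cast
      rfl
    have e3 : ∑ x ∈ X, (#{y ∈ Y | (x, y) ∈ E} : ℝ) ≤
        ∑ x ∈ X₁, (#{y ∈ Y | (x, y) ∈ E} : ℝ) + #X * (h * #Y / 2) := by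
      rw [← sum_filter_add_sum_filter_not X
        (fun x => h * #Y ≤ 2 * (#{y ∈ Y | (x, y) ∈ E} : ℝ))]
      gcongr
      calc _ ≤ ∑ x ∈ X with ¬ h * #Y ≤ 2 * (#{y ∈ Y | (x, y) ∈ E} : ℝ), h * #Y / 2 := by
            refine sum_le_sum fun x hx => ?_
            have := (mem_filter.1 hx).2
            push Not at this
            linarith
        _ ≤ _ := by
            rw [sum_const, nsmul_eq_mul]
            gcongr
            exact filter_subset _ _
    rw [e2]
    rw [e1] at hcard
    linarith
  obtain ⟨X₂, hX₂sub, hX₂card, hX₂bad⟩ := exists_subset_few_bad_pairs X₁ Y E (b := h / 2)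
    (c := h ^ 3 / 128) (ε := h / 16) (card_le_card hX₁sub) hY hX.card_pos (by positivity)
    (by positivity) (by ring) hdense
  have hX₂pos : (0 : ℝ) < #X₂ := by
    have : 0 < h / 2 * #X := by positivity
    linarith
  set bad : α → Finset α := fun x =>
    {x' ∈ X₂ | (#{y ∈ Y | (x, y) ∈ E ∧ (x', y) ∈ E} : ℝ) < h ^ 3 / 128 * #Y} with hbad
  have hbadsum : ∑ x ∈ X₂, (#(bad x) : ℝ) ≤ h / 16 * #X₂ ^ 2 := by
    refine le_trans (le_of_eq ?_) hX₂bad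
    rw [card_filter, sum_product]
    push_cast
    refine sum_congr rfl fun x _ => ?_
    rw [hbad, card_filter]
    push_cast
    rfl
  set X' : Finset α := {x ∈ X₂ | (#(bad x) : ℝ) ≤ h / 8 * #X₂} with hX'
  set Y' : Finset β := {y ∈ Y | h * #X₂ ≤ 4 * (#{x ∈ X₂ | (x, y) ∈ E} : ℝ)} with hY'
  refine ⟨X', (filter_subset _ _).trans (hX₂sub.trans hX₁sub), Y', filter_subset _ _, ?_, ?_, ?_⟩
  · have e1 : ∑ x ∈ X₂ with ¬ (#(bad x) : ℝ) ≤ h / 8 * #X₂, (h / 8 * #X₂ : ℝ) ≤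
        ∑ x ∈ X₂, (#(bad x) : ℝ) := by
      refine (sum_le_sum fun x hx => ?_).trans
        (sum_le_sum_of_subset_of_nonneg (filter_subset _ _) fun _ _ _ => Nat.cast_nonneg _)
      have := (mem_filter.1 hx).2
      push Not at this
      exact this.le
    rw [sum_const, nsmul_eq_mul] at e1
    have e2 := card_filter_add_card_filter_not (s := X₂) (fun x => (#(bad x) : ℝ) ≤ h / 8 * #X₂)
    set Z := #{x ∈ X₂ | ¬ (#(bad x) : ℝ) ≤ h / 8 * #X₂}
    have e3 : (#X' : ℝ) + Z = #X₂ := by exact_mod_cast e2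
    have e4 : (Z : ℝ) ≤ #X₂ / 2 := by
      refine le_of_mul_le_mul_right ?_ (by positivity : (0 : ℝ) < h / 8 * #X₂)
      nlinarith
    linarith
  · have e1 : (#X₂ : ℝ) * (h * #Y / 2) ≤ ∑ y ∈ Y, (#{x ∈ X₂ | (x, y) ∈ E} : ℝ) := by
      calc (#X₂ : ℝ) * (h * #Y / 2) = ∑ x ∈ X₂, h * #Y / 2 := by rw [sum_const, nsmul_eq_mul]
        _ ≤ ∑ x ∈ X₂, (#{y ∈ Y | (x, y) ∈ E} : ℝ) := by
            refine sum_le_sum fun x hx => ?_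
            have := (mem_filter.1 (hX₂sub hx)).2
            linarith
        _ = _ := by
            simp_rw [card_filter]
            push_cast
            exact sum_comm
    have e2 : ∑ y ∈ Y, (#{x ∈ X₂ | (x, y) ∈ E} : ℝ) ≤ #Y' * #X₂ + #Y * (h * #X₂ / 4) := by
      rw [← sum_filter_add_sum_filter_not Y
        (fun y => h * #X₂ ≤ 4 * (#{x ∈ X₂ | (x, y) ∈ E} : ℝ))]
      refine add_le_add ?_ ?_
      · rw [← nsmul_eq_mul, ← sum_const]
        refine sum_le_sum fun y _ => ?_
        exact_mod_cast card_filter_le _ _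
      · calc _ ≤ ∑ y ∈ Y with ¬ h * #X₂ ≤ 4 * (#{x ∈ X₂ | (x, y) ∈ E} : ℝ), h * #X₂ / 4 := by
              refine sum_le_sum fun x hx => ?_
              have := (mem_filter.1 hx).2
              push Not at this
              linarith
          _ ≤ _ := by
              rw [sum_const, nsmul_eq_mul]
              gcongr
              exact filter_subset _ _
    have e3 : h * #Y / 4 ≤ #Y' := by
      refine le_of_mul_le_mul_right ?_ hX₂pos
      nlinarith
    linarith [Nat.cast_nonneg (α := ℝ) #Y']
  · intro x hx y hy
    have hx2 := mem_filter.1 hx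
    have hy2 := mem_filter.1 hy
    -- Paths have the form `x, y', x', y`: `x'` is a neighbour of `y` sharing many neighbours `y'`
    -- with `x`.
    set good : Finset α := {x' ∈ X₂ | (x', y) ∈ E} \ bad x with hgood
    have hgoodcard : h / 8 * #X₂ ≤ #good := by
      have h0 := le_card_sdiff (bad x) {x' ∈ X₂ | (x', y) ∈ E}
      rw [← hgood] at h0
      have : (#{x' ∈ X₂ | (x', y) ∈ E} : ℝ) ≤ #good + #(bad x) := by
        have h3 : #{x' ∈ X₂ | (x', y) ∈ E} ≤ #good + #(bad x) := by omega
        exact_mod_cast h3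
      linarith [hx2.2, hy2.2]
    have hpaths : (#good : ℝ) * (h ^ 3 / 128 * #Y) ≤
        #{p ∈ X ×ˢ Y | (x, p.2) ∈ E ∧ p ∈ E ∧ (p.1, y) ∈ E} := by
      calc (#good : ℝ) * (h ^ 3 / 128 * #Y) = ∑ x' ∈ good, h ^ 3 / 128 * #Y := by
            rw [sum_const, nsmul_eq_mul]
        _ ≤ ∑ x' ∈ good, (#{y' ∈ Y | (x, y') ∈ E ∧ (x', y') ∈ E} : ℝ) := by
            refine sum_le_sum fun x' hx' => ?_
            obtain ⟨h1, h2⟩ := mem_sdiff.1 hx'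
            by_contra hcon
            push Not at hcon
            exact h2 (mem_filter.2 ⟨(mem_filter.1 h1).1, hcon⟩)
        _ = (#(good.sigma fun x' => {y' ∈ Y | (x, y') ∈ E ∧ (x', y') ∈ E}) : ℝ) := by
            rw [card_sigma]
            push_cast
            rfl
        _ ≤ _ := by
            refine Nat.cast_le.2 (card_le_card_of_injOn (fun p => (p.1, p.2)) ?_ ?_)
            · rintro ⟨x', y'⟩ hp
              simp only [coe_sigma, Set.mem_sigma_iff, mem_coe, hgood, mem_sdiff,
                mem_filter] at hp
              simp only [coe_filter, mem_product, Set.mem_ofPred_eq]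
              exact ⟨⟨hX₁sub (hX₂sub hp.1.1.1), hp.2.1⟩, hp.2.2.1, hp.2.2.2, hp.1.1.2⟩
            · rintro ⟨x', y'⟩ _ ⟨x'', y''⟩ _ heq
              simp only [Prod.mk.injEq] at heq
              obtain ⟨rfl, rfl⟩ := heq
              rfl
    have h5 : h / 8 * #X₂ * (h ^ 3 / 128 * #Y) ≤ #good * (h ^ 3 / 128 * #Y) := by gcongr
    have h6 : h / 8 * (h / 3 * #X) * (h ^ 3 / 128 * #Y) ≤ h / 8 * #X₂ * (h ^ 3 / 128 * #Y) := by
      gcongr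
      linarith
    have h7 : 0 ≤ h ^ 5 * (#X * #Y) := by positivity
    nlinarith

variable {F : Type*} [Field F] [DecidableEq F]

/-- **Balog–Szemerédi–Gowers** for the sums `x + r y` along the edges of a bipartite graph. -/
lemma exists_card_add_smul_le (X Y S : Finset F) (E : Finset (F × F)) {r : F} (hr : r ≠ 0) {h : ℝ}
    (hh : 0 < h) (hX : X.Nonempty) (hY : Y.Nonempty) (hE : E ⊆ X ×ˢ Y)
    (hcard : h * (#X * #Y) ≤ #E) (hS : ∀ p ∈ E, p.1 + r * p.2 ∈ S) :
    ∃ X' ⊆ X, ∃ Y' ⊆ Y, h * #X ≤ 8 * #X' ∧ h * #Y ≤ 8 * #Y' ∧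
      h ^ 5 * (#X * #Y) * #(X' + r • Y') ≤ 4096 * (#S : ℝ) ^ 3 := by
  obtain ⟨X', hX', Y', hY', hXc, hYc, hpath⟩ :=
    exists_many_paths_of_length_three X Y E hh hX hY hE hcard
  refine ⟨X', hX', Y', hY', hXc, hYc, ?_⟩
  -- Along such a path, `x + r y = (x + r y') - (x' + r y') + (x' + r y)`. Each sum thus has many
  -- representations by triples from `S`, of which there are `|S|^3`.
  set f : F × F × F → F := fun s => s.1 - s.2.1 + s.2.2 with hf
  have hfib : ∀ z ∈ X' + r • Y', h ^ 5 * (#X * #Y) ≤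
      4096 * (#{s ∈ S ×ˢ S ×ˢ S | f s = z} : ℝ) := by
    intro z hz
    obtain ⟨x, hx, w, hw, rfl⟩ := mem_add.1 hz
    obtain ⟨y, hy, rfl⟩ := mem_smul_finset.1 hw
    refine (hpath x hx y hy).trans ?_
    gcongr 4096 * ?_
    refine Nat.cast_le.2 (card_le_card_of_injOn
      (fun p => (x + r * p.2, p.1 + r * p.2, p.1 + r * y)) ?_ ?_)
    · intro p hp
      simp only [coe_filter, mem_product, Set.mem_ofPred_eq] at hp ⊢
      refine ⟨⟨hS _ hp.2.1, hS _ hp.2.2.1, hS _ hp.2.2.2⟩, ?_⟩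
      simp only [hf, smul_eq_mul]
      ring
    · intro p _ q _ hpq
      simp only [Prod.mk.injEq, add_right_inj, add_left_inj, mul_eq_mul_left_iff, hr,
        or_false] at hpq
      exact Prod.ext hpq.2.2 hpq.1
  calc h ^ 5 * (#X * #Y) * #(X' + r • Y') = ∑ z ∈ X' + r • Y', h ^ 5 * (#X * #Y : ℝ) := by
        rw [sum_const, nsmul_eq_mul]
        ring
    _ ≤ ∑ z ∈ X' + r • Y', 4096 * (#{s ∈ S ×ˢ S ×ˢ S | f s = z} : ℝ) := sum_le_sum hfib
    _ = 4096 * ((∑ z ∈ X' + r • Y', #{s ∈ S ×ˢ S ×ˢ S | f s = z} : ℕ) : ℝ) := by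
        rw [← mul_sum]
        push_cast
        rfl
    _ ≤ 4096 * ((#S ^ 3 : ℕ) : ℝ) := by
        gcongr 4096 * ?_
        refine Nat.cast_le.2 ?_
        rw [sum_card_fiberwise_eq_card_filter]
        refine (card_filter_le _ _).trans (le_of_eq ?_)
        rw [card_product, card_product]
        ring
    _ = _ := by push_cast; ring

/-- Among many dense subsets of a set, one of them intersects many of the others substantially. -/
lemma exists_popular_subset {ι Ω : Type*} [DecidableEq Ω] (T : Finset ι) (O : Finset Ω)
    (W : ι → Finset Ω) {b : ℝ} (hb : 0 ≤ b) (hT : T.Nonempty) (hO : O.Nonempty)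
    (hW : ∀ i ∈ T, W i ⊆ O) (hcard : ∀ i ∈ T, b * #O ≤ #(W i)) :
    ∃ i₀ ∈ T, b ^ 2 * #T ≤
      2 * (#{i ∈ T | b ^ 2 * #O ≤ 2 * (#(W i ∩ W i₀) : ℝ)} : ℝ) := by
  have hTpos : (0 : ℝ) < #T := by exact_mod_cast hT.card_pos
  have hOpos : (0 : ℝ) < #O := by exact_mod_cast hO.card_pos
  have h1 : ∑ i ∈ T, (#(W i) : ℝ) = ∑ ω ∈ O, (#{i ∈ T | ω ∈ W i} : ℝ) := by
    have : ∀ i ∈ T, (#(W i) : ℝ) = ∑ ω ∈ O, if ω ∈ W i then (1 : ℝ) else 0 := by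
      intro i hi
      rw [← sum_filter, sum_const, nsmul_eq_mul, mul_one]
      congr 2
      ext ω
      simp only [mem_filter]
      exact ⟨fun h => ⟨hW i hi h, h⟩, fun h => h.2⟩
    rw [sum_congr rfl this, sum_comm]
    refine sum_congr rfl fun ω _ => ?_
    rw [← sum_filter, sum_const, nsmul_eq_mul, mul_one]
  have h2 : b * #O * #T ≤ ∑ ω ∈ O, (#{i ∈ T | ω ∈ W i} : ℝ) := by
    rw [← h1]
    calc b * #O * #T = ∑ i ∈ T, b * (#O : ℝ) := by rw [sum_const, nsmul_eq_mul]; ring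
      _ ≤ _ := sum_le_sum hcard
  have h3 : ∑ ω ∈ O, (#{i ∈ T | ω ∈ W i} : ℝ) ^ 2 =
      ∑ j ∈ T, ∑ i ∈ T, (#(W i ∩ W j) : ℝ) := by
    have e : ∀ j ∈ T, ∀ i ∈ T, (#(W i ∩ W j) : ℝ) =
        ∑ ω ∈ O, (if ω ∈ W i then (1 : ℝ) else 0) * (if ω ∈ W j then (1 : ℝ) else 0) := by
      intro j hj i hi
      simp_rw [ite_zero_mul_ite_zero, mul_one]
      rw [← sum_filter, sum_const, nsmul_eq_mul, mul_one]
      congr 2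
      ext ω
      simp only [mem_filter, mem_inter]
      exact ⟨fun h => ⟨hW i hi h.1, h⟩, fun h => h.2⟩
    rw [sum_congr rfl fun j hj => sum_congr rfl fun i hi => e j hj i hi]
    rw [sum_congr rfl fun j _ => sum_comm, sum_comm]
    refine sum_congr rfl fun ω _ => ?_
    simp_rw [← sum_mul, ← mul_sum]
    rw [← sum_filter, sum_const, nsmul_eq_mul, mul_one, sq]
  have h4 := sq_sum_le_card_mul_sum_sq (s := O) (f := fun ω => (#{i ∈ T | ω ∈ W i} : ℝ))
  have h5 : b ^ 2 * #O * #T ^ 2 ≤ ∑ j ∈ T, ∑ i ∈ T, (#(W i ∩ W j) : ℝ) := by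
    rw [← h3]
    refine le_of_mul_le_mul_left ?_ hOpos
    have : (b * #O * #T) ^ 2 ≤ (∑ ω ∈ O, (#{i ∈ T | ω ∈ W i} : ℝ)) ^ 2 := by gcongr
    nlinarith
  obtain ⟨j, hj, hjle⟩ : ∃ j ∈ T, b ^ 2 * #O * #T ≤ ∑ i ∈ T, (#(W i ∩ W j) : ℝ) := by
    refine exists_le_of_sum_le hT ?_
    rw [sum_const, nsmul_eq_mul]
    nlinarith
  refine ⟨j, hj, ?_⟩
  set Z : Finset ι := {i ∈ T | b ^ 2 * #O ≤ 2 * (#(W i ∩ W j) : ℝ)} with hZ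
  have h6 : ∑ i ∈ T, (#(W i ∩ W j) : ℝ) ≤ #Z * #O + #T * (b ^ 2 * #O / 2) := by
    rw [← sum_filter_add_sum_filter_not T (fun i => b ^ 2 * #O ≤ 2 * (#(W i ∩ W j) : ℝ))]
    refine add_le_add ?_ ?_
    · rw [← nsmul_eq_mul, ← sum_const]
      refine sum_le_sum fun i hi => ?_
      exact_mod_cast card_le_card (inter_subset_left.trans (hW i (mem_filter.1 hi).1))
    · calc _ ≤ ∑ i ∈ T with ¬ b ^ 2 * #O ≤ 2 * (#(W i ∩ W j) : ℝ), b ^ 2 * #O / 2 := by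
            refine sum_le_sum fun x hx => ?_
            have := (mem_filter.1 hx).2
            push Not at this
            linarith
        _ ≤ _ := by
            rw [sum_const, nsmul_eq_mul]
            gcongr
            exact filter_subset _ _
  refine le_of_mul_le_mul_right ?_ hOpos
  nlinarith

end BalogSzemerediGowers

/-! ### From sums along dense graphs to a set with many good dilations. -/

section GraphsToDilates

open Finset
open scoped Pointwise

variable {F : Type*} [Field F] [DecidableEq F]

lemma card_sub_div_smul (V : Finset F) {r r₀ : F} (hr₀ : r₀ ≠ 0) :
    #(V - (r / r₀) • V) = #(r₀ • V - r • V) := by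
  rw [← card_smul_finset₀ hr₀ (V - (r / r₀) • V), smul_finset_sub_eq, ← mul_smul,
    mul_div_cancel₀ _ hr₀]

/-- Two triangle inequalities: `r₀ • V` is compared with `r • Yi` through `Xi`, and then `r • Yi`
with `r • V` through the difference set of `V`. This is why the sets found for `r` and `r₀` must
overlap in both coordinates. -/
lemma card_smul_sub_smul_mul_le {U V Xi Yi : Finset F} {r r₀ : F} (hr : r ≠ 0)
    {P D : ℝ} (hXi : Xi ⊆ U) (hYi : Yi ⊆ V) (hP : (#(U + r₀ • V) : ℝ) ≤ P)
    (hP' : (#(Xi + r • Yi) : ℝ) ≤ P) (hD : (#(V - V) : ℝ) ≤ D) :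
    (#(r₀ • V - r • V) : ℝ) * (#Xi * #Yi) ≤ P * P * D := by
  have h1 : (#(r₀ • V - r • Yi) : ℝ) * #Xi ≤ P * P := by
    have h := ruzsa_triangle_inequality_sub_add_add (r₀ • V) Xi (r • Yi)
    have hA : (#(r₀ • V + Xi) : ℝ) ≤ P := by
      refine le_trans ?_ hP
      rw [add_comm]
      exact_mod_cast card_le_card (add_subset_add_right hXi)
    have hB : (#(r • Yi + Xi) : ℝ) ≤ P := by rwa [add_comm]
    calc (#(r₀ • V - r • Yi) : ℝ) * #Xi ≤ #(r₀ • V + Xi) * #(r • Yi + Xi) := by exact_mod_cast h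
      _ ≤ _ := mul_le_mul hA hB (Nat.cast_nonneg _) ((Nat.cast_nonneg _).trans hA)
  have h2 : (#(r₀ • V - r • V) : ℝ) * #Yi ≤ #(r₀ • V - r • Yi) * D := by
    have h := card_sub_mul_card_le (r₀ • V) (r • Yi) (r • V)
    rw [card_smul_finset₀ hr, ← smul_finset_sub_eq r Yi V, card_smul_finset₀ hr] at h
    have hB : (#(Yi - V) : ℝ) ≤ D := by
      refine le_trans ?_ hD
      exact_mod_cast card_le_card (sub_subset_sub_right hYi)
    calc (#(r₀ • V - r • V) : ℝ) * #Yi ≤ #(r₀ • V - r • Yi) * #(Yi - V) := by exact_mod_cast h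
      _ ≤ _ := mul_le_mul_of_nonneg_left hB (Nat.cast_nonneg _)
  have hD0 : 0 ≤ D := (Nat.cast_nonneg _).trans hD
  calc (#(r₀ • V - r • V) : ℝ) * (#Xi * #Yi) = (#(r₀ • V - r • V) : ℝ) * #Yi * #Xi := by ring
    _ ≤ #(r₀ • V - r • Yi) * D * #Xi := mul_le_mul_of_nonneg_right h2 (Nat.cast_nonneg _)
    _ = (#(r₀ • V - r • Yi) : ℝ) * #Xi * D := by ring
    _ ≤ P * P * D := mul_le_mul_of_nonneg_right h1 hD0

/-- If for many `r` the sums `x + r y` along a dense subgraph of `X × Y` take few values, then some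
`V ⊆ Y` is barely expanded by many dilations. -/
theorem exists_dilateBounded_of_graphs (X Y T : Finset F) (E : F → Finset (F × F))
    (S : F → Finset F) {Θ a : ℝ} (ha : 0 < a) (hΘ : 64 ≤ Θ) (hT : T.Nonempty)
    (h0 : ∀ r ∈ T, r ≠ 0) (hE : ∀ r ∈ T, E r ⊆ X ×ˢ Y)
    (hcard : ∀ r ∈ T, 64 * (#X * #Y) ≤ Θ * #(E r))
    (hS : ∀ r ∈ T, ∀ p ∈ E r, p.1 + r * p.2 ∈ S r) (hSc : ∀ r ∈ T, 64 * #(S r) ≤ Θ * a)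
    (hX : 64 * a ≤ Θ * #X) (hY : 64 * a ≤ Θ * #Y) :
    ∃ V : Finset F, ∃ r₀ ∈ T, ∃ T' ⊆ T, (#T : ℝ) ≤ Θ ^ 4 * #T' ∧
      DilateBounded V (Θ ^ 24) 1 ∧ (∀ r ∈ T', DilateBounded V (Θ ^ 50) (r / r₀)) ∧
      a ≤ Θ ^ 2 * #V ∧ #V ≤ Θ ^ 10 * a := by
  have hΘ0 : 0 < Θ := by linarith
  have hΘ1 : 1 ≤ Θ := by linarith
  have pos_of : ∀ Z : Finset F, 64 * a ≤ Θ * #Z → (0 : ℝ) < #Z := by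
    intro Z hZ
    by_contra h
    push Not at h
    nlinarith
  have hXpos := pos_of X hX
  have hYpos := pos_of Y hY
  have hXne : X.Nonempty := card_pos.1 (by exact_mod_cast hXpos)
  have hYne : Y.Nonempty := card_pos.1 (by exact_mod_cast hYpos)
  have hXY : 64 ^ 2 * a ^ 2 ≤ Θ ^ 2 * (#X * #Y) := by
    calc 64 ^ 2 * a ^ 2 = (64 * a) * (64 * a) := by ring
      _ ≤ (Θ * #X) * (Θ * #Y) := by gcongr
      _ = _ := by ring
  have hbsg : ∀ r ∈ T, ∃ X' ⊆ X, ∃ Y' ⊆ Y, 8 * #X ≤ Θ * #X' ∧ 8 * #Y ≤ Θ * #Y' ∧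
      (#(X' + r • Y') : ℝ) ≤ Θ ^ 10 * a := by
    intro r hr
    obtain ⟨X', hX', Y', hY', h1, h2, h3⟩ := exists_card_add_smul_le X Y (S r) (E r) (h0 r hr)
      (h := 64 / Θ) (by positivity) hXne hYne (hE r hr)
      (by rw [div_mul_eq_mul_div, div_le_iff₀ hΘ0]; linarith [hcard r hr]) (hS r hr)
    refine ⟨X', hX', Y', hY', ?_, ?_, ?_⟩
    · rw [div_mul_eq_mul_div, div_le_iff₀ hΘ0] at h1
      linarith
    · rw [div_mul_eq_mul_div, div_le_iff₀ hΘ0] at h2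
      linarith
    · set Q : ℝ := (#(X' + r • Y') : ℝ)
      have hQ : 0 ≤ Q := Nat.cast_nonneg _
      have h4 : 64 ^ 5 * (#X * #Y) * Q ≤ 4096 * (#(S r)) ^ 3 * Θ ^ 5 := by
        have : (64 / Θ) ^ 5 * (#X * #Y) * Q = 64 ^ 5 * (#X * #Y) * Q / Θ ^ 5 := by
          rw [div_pow]
          ring
        rw [this, div_le_iff₀ (by positivity)] at h3
        exact h3
      have h5 : (64 * (#(S r) : ℝ)) ^ 3 ≤ (Θ * a) ^ 3 := by
        exact pow_le_pow_left₀ (by positivity) (hSc r hr) 3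
      have h6 : 64 ^ 7 * a ^ 2 * Q ≤ 64 ^ 5 * (#X * #Y) * Q * Θ ^ 2 := by
        have := mul_le_mul_of_nonneg_right hXY (by positivity : 0 ≤ 64 ^ 5 * Q)
        linarith
      have h7 : 64 ^ 5 * (#X * #Y) * Q * Θ ^ 2 ≤ 4096 * (#(S r)) ^ 3 * Θ ^ 5 * Θ ^ 2 := by gcongr
      have h8 : 4096 * (#(S r) : ℝ) ^ 3 * Θ ^ 5 * Θ ^ 2 ≤ (Θ * a) ^ 3 * Θ ^ 7 := by
        have h9 := mul_le_mul_of_nonneg_right h5 (by positivity : 0 ≤ Θ ^ 7)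
        have : 0 ≤ (#(S r) : ℝ) ^ 3 * Θ ^ 7 := by positivity
        linarith
      have h9 : 64 ^ 7 * Q * a ^ 2 ≤ Θ ^ 10 * a * a ^ 2 := by linarith
      have h10 := le_of_mul_le_mul_right h9 (by positivity : 0 < a ^ 2)
      linarith
  choose! X' hX' Y' hY' hXc hYc hsum using hbsg
  -- The sets `X' r`, `Y' r` vary with `r`; a popular `r₀` supplies a common `V = Y' r₀` for many
  -- `r`.
  obtain ⟨r₀, hr₀, hpop⟩ := exists_popular_subset T (X ×ˢ Y) (fun r => X' r ×ˢ Y' r)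
    (b := 64 / Θ ^ 2) (by positivity) hT (hXne.product hYne)
    (fun r hr => product_subset_product (hX' r hr) (hY' r hr)) (by
      intro r hr
      rw [div_mul_eq_mul_div, div_le_iff₀ (by positivity), card_product, card_product]
      push_cast
      calc (64 * (#X * #Y) : ℝ) = (8 * #X) * (8 * #Y) := by ring
        _ ≤ (Θ * #(X' r)) * (Θ * #(Y' r)) :=
            mul_le_mul (hXc r hr) (hYc r hr) (by positivity) (by positivity)
        _ = _ := by ring)
  set T' : Finset F := {r ∈ T | (64 / Θ ^ 2) ^ 2 * (#(X ×ˢ Y) : ℝ) ≤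
    2 * (#(X' r ×ˢ Y' r ∩ X' r₀ ×ˢ Y' r₀) : ℝ)} with hT'
  set U := X' r₀
  set V := Y' r₀
  have hU : a ≤ Θ ^ 2 * #U := by nlinarith [hXc r₀ hr₀]
  have hV : a ≤ Θ ^ 2 * #V := by nlinarith [hYc r₀ hr₀]
  have hUpos : (0 : ℝ) < #U := by
    by_contra h
    push Not at h
    nlinarith [pow_pos hΘ0 2]
  have hVpos : (0 : ℝ) < #V := by
    by_contra h
    push Not at h
    nlinarith [pow_pos hΘ0 2]
  have hr₀0 := h0 r₀ hr₀
  have hVV : (#(V - V) : ℝ) ≤ Θ ^ 22 * a := by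
    have h1 := ruzsa_triangle_inequality_sub_add_add (r₀ • V) U (r₀ • V)
    rw [← smul_finset_sub_eq, card_smul_finset₀ hr₀0, add_comm] at h1
    have h2 : (#(V - V) : ℝ) * #U ≤ #(U + r₀ • V) * #(U + r₀ • V) := by exact_mod_cast h1
    have h3 : (#(V - V) : ℝ) * #U ≤ (Θ ^ 10 * a) * (Θ ^ 10 * a) :=
      h2.trans (by gcongr <;> exact hsum r₀ hr₀)
    refine le_of_mul_le_mul_right ?_ hUpos
    calc (#(V - V) : ℝ) * #U ≤ Θ ^ 20 * a * a := by linarith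
      _ ≤ Θ ^ 20 * a * (Θ ^ 2 * #U) := by gcongr
      _ = _ := by ring
  refine ⟨V, r₀, hr₀, T', filter_subset _ _, ?_, ?_, ?_, hV, ?_⟩
  · have h1 : (64 / Θ ^ 2) ^ 2 = 64 ^ 2 / Θ ^ 4 := by
      rw [div_pow]
      ring
    rw [h1, div_mul_eq_mul_div, div_le_iff₀ (by positivity)] at hpop
    have : 0 ≤ (#T : ℝ) := Nat.cast_nonneg _
    linarith
  · unfold DilateBounded
    rw [one_smul]
    calc (#(V - V) : ℝ) ≤ Θ ^ 22 * a := hVV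
      _ ≤ Θ ^ 22 * (Θ ^ 2 * #V) := by gcongr
      _ = _ := by ring
  · intro r hr
    obtain ⟨hrT, hrW⟩ := mem_filter.1 hr
    set Xi := X' r ∩ U with hXi
    set Yi := Y' r ∩ V with hYi
    have e1 : a ^ 2 ≤ Θ ^ 6 * (#Xi * #Yi) := by
      rw [product_inter_product, card_product, card_product] at hrW
      have h1 : (64 / Θ ^ 2) ^ 2 = 64 ^ 2 / Θ ^ 4 := by
        rw [div_pow]
        ring
      rw [h1, div_mul_eq_mul_div, div_le_iff₀ (by positivity)] at hrW
      push_cast at hrW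
      have h2 := mul_le_mul_of_nonneg_right hrW (by positivity : 0 ≤ Θ ^ 2)
      have h3 : 0 ≤ a ^ 2 := by positivity
      nlinarith
    have hpos : (0 : ℝ) < #Xi * #Yi := by
      by_contra h
      push Not at h
      nlinarith [pow_pos hΘ0 6, pow_pos ha 2]
    have hXipos : (0 : ℝ) < #Xi := by
      refine lt_of_le_of_ne (Nat.cast_nonneg _) fun h => ?_
      rw [← h, zero_mul] at hpos
      exact lt_irrefl _ hpos
    have hYipos : (0 : ℝ) < #Yi := by
      refine lt_of_le_of_ne (Nat.cast_nonneg _) fun h => ?_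
      rw [← h, mul_zero] at hpos
      exact lt_irrefl _ hpos
    have hr0 := h0 r hrT
    have h3 := card_smul_sub_smul_mul_le hr0 (U := U) (V := V) (Xi := Xi) (Yi := Yi)
      inter_subset_right inter_subset_right (hsum r₀ hr₀)
      ((Nat.cast_le.2 (card_le_card (add_subset_add inter_subset_left
        (smul_finset_subset_smul_finset inter_subset_left)))).trans (hsum r hrT)) hVV
    have h4 : (#(r₀ • V - r • V) : ℝ) ≤ Θ ^ 48 * a := by
      refine le_of_mul_le_mul_right (h3.trans ?_) hpos
      have h6 := mul_le_mul_of_nonneg_left e1 (by positivity : 0 ≤ Θ ^ 42 * a)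
      calc _ = Θ ^ 42 * a * a ^ 2 := by ring
        _ ≤ _ := h6
        _ = _ := by ring
    unfold DilateBounded
    rw [card_sub_div_smul V hr₀0]
    calc (#(r₀ • V - r • V) : ℝ) ≤ Θ ^ 48 * a := h4
      _ ≤ Θ ^ 48 * (Θ ^ 2 * #V) := by gcongr
      _ = _ := by ring
  · refine le_trans ?_ (hsum r₀ hr₀)
    have h1 : #(r₀ • V) ≤ #(U + r₀ • V) :=
      card_le_card_add_left (card_pos.1 (by exact_mod_cast hUpos))
    rw [card_smul_finset₀ hr₀0] at h1
    exact_mod_cast h1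

end GraphsToDilates

/-! ### Collinear triples on a pencil of parallel fibres. -/

section Pencils

open Finset
open scoped Pointwise

lemma card_pow_three_le_card_distinct_triples {α : Type*} [DecidableEq α] (A : Finset α) :
    #A ^ 3 ≤ #{t ∈ A ×ˢ A ×ˢ A | t.1 ≠ t.2.1 ∧ t.2.2 ≠ t.1 ∧ t.2.2 ≠ t.2.1} + 3 * #A ^ 2 := by
  have hsub : A ×ˢ A ×ˢ A ⊆ {t ∈ A ×ˢ A ×ˢ A | t.1 ≠ t.2.1 ∧ t.2.2 ≠ t.1 ∧ t.2.2 ≠ t.2.1} ∪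
      ((A ×ˢ A).image (fun p => (p.1, p.1, p.2)) ∪ ((A ×ˢ A).image (fun p => (p.1, p.2, p.1)) ∪
        (A ×ˢ A).image (fun p => (p.1, p.2, p.2)))) := by
    rintro ⟨x, y, z⟩ ht
    simp only [mem_product] at ht
    simp only [mem_union, mem_filter, mem_product, mem_image, Prod.mk.injEq, Prod.exists]
    by_cases h1 : x = y
    · subst h1
      exact Or.inr (Or.inl ⟨x, z, ⟨ht.1, ht.2.2⟩, rfl, rfl, rfl⟩)
    by_cases h2 : z = x
    · subst h2
      exact Or.inr (Or.inr (Or.inl ⟨z, y, ⟨ht.1, ht.2.1⟩, rfl, rfl, rfl⟩))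
    by_cases h3 : z = y
    · subst h3
      exact Or.inr (Or.inr (Or.inr ⟨x, z, ⟨ht.1, ht.2.1⟩, rfl, rfl, rfl⟩))
    exact Or.inl ⟨ht, h1, h2, h3⟩
  have h := card_le_card hsub
  have hi : ∀ f : α × α → α × α × α, #((A ×ˢ A).image f) ≤ #A ^ 2 := fun f =>
    card_image_le.trans (le_of_eq (by rw [card_product, sq]))
  have e : #(A ×ˢ A ×ˢ A) = #A ^ 3 := by
    rw [card_product, card_product]
    ring
  rw [e] at h
  refine h.trans ((card_union_le _ _).trans ?_)
  gcongr
  refine (card_union_le _ _).trans ?_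
  have h1 := hi fun p => (p.1, p.1, p.2)
  have h2 := (card_union_le _ _).trans (add_le_add (hi fun p => (p.1, p.2, p.1))
    (hi fun p => (p.1, p.2, p.2)))
  omega

/-- The power mean inequality, counting triples of distinct elements in a family of sets. -/
lemma le_sum_card_distinct_triples {ι α : Type*} [DecidableEq α] (Λ : Finset ι) (A : ι → Finset α)
    {n : ℕ} {s : ℝ} (hn : #Λ ≤ n) (hs : s ≤ ∑ l ∈ Λ, (#(A l) : ℝ)) (hns : 4 * n ≤ s) (hn0 : 0 < n) :
    s ^ 3 ≤ 4 * n ^ 2 * ∑ l ∈ Λ,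
      (#{t ∈ A l ×ˢ A l ×ˢ A l | t.1 ≠ t.2.1 ∧ t.2.2 ≠ t.1 ∧ t.2.2 ≠ t.2.1} : ℝ) := by
  have hnpos : (0 : ℝ) < n := by exact_mod_cast hn0
  have hΛ : (0 : ℝ) < #Λ := by
    rcases Λ.eq_empty_or_nonempty with rfl | h
    · simp only [sum_empty] at hs
      linarith
    · exact_mod_cast h.card_pos
  have hpm := pow_sum_div_card_le_sum_pow (s := Λ) (f := fun l => (#(A l) : ℝ))
    (fun _ _ => Nat.cast_nonneg _) 2
  rw [div_le_iff₀ (by positivity)] at hpm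
  norm_num at hpm
  have h1 : s ^ 3 ≤ (∑ l ∈ Λ, (#(A l) : ℝ)) ^ 3 := by
    have : 0 ≤ s := by linarith
    gcongr
  have h2 : s ^ 3 ≤ n ^ 2 * ∑ l ∈ Λ, (#(A l) : ℝ) ^ 3 := by
    calc s ^ 3 ≤ (∑ l ∈ Λ, (#(A l) : ℝ) ^ 3) * #Λ ^ 2 := h1.trans hpm
      _ ≤ (∑ l ∈ Λ, (#(A l) : ℝ) ^ 3) * n ^ 2 := by gcongr
      _ = _ := mul_comm _ _
  have h3 : ∑ l ∈ Λ, (#(A l) : ℝ) ^ 3 ≤ 2 * ∑ l ∈ Λ,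
      (#{t ∈ A l ×ˢ A l ×ˢ A l | t.1 ≠ t.2.1 ∧ t.2.2 ≠ t.1 ∧ t.2.2 ≠ t.2.1} : ℝ) + 32 * #Λ := by
    have : (32 * #Λ : ℝ) = ∑ l ∈ Λ, 32 := by
      rw [sum_const, nsmul_eq_mul, mul_comm]
    rw [this, mul_sum, ← sum_add_distrib]
    refine sum_le_sum fun l _ => ?_
    have h4 : (#(A l) : ℝ) ^ 3 ≤ (#{t ∈ A l ×ˢ A l ×ˢ A l |
        t.1 ≠ t.2.1 ∧ t.2.2 ≠ t.1 ∧ t.2.2 ≠ t.2.1} : ℝ) + 3 * (#(A l) : ℝ) ^ 2 := by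
      exact_mod_cast card_pow_three_le_card_distinct_triples (A l)
    have h5 : (0 : ℝ) ≤ #(A l) := Nat.cast_nonneg _
    -- `k^3 - 6 k^2 + 32 = (k + 2)(k - 4)^2`, so triples with a repetition cost at most `k^3 / 2 +
    -- 16`.
    nlinarith [mul_nonneg (by linarith : 0 ≤ (#(A l) : ℝ) + 2) (sq_nonneg ((#(A l) : ℝ) - 4))]
  have h6 : (32 : ℝ) * #Λ ≤ 32 * n := by gcongr
  have h7 : (4 * (n : ℝ)) ^ 3 ≤ s ^ 3 := by gcongr
  have h8 := mul_le_mul_of_nonneg_left (h3.trans (add_le_add le_rfl h6))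
    (by positivity : 0 ≤ (n : ℝ) ^ 2)
  nlinarith

variable {F : Type*} [Field F] [DecidableEq F]

/-- Pairs of points on the fibres over `m₀` and `m₁` that span a non-horizontal line meeting the
fibre over `m`. -/
def collinearPairs (B : F → Finset F) (m₀ m₁ m : F) : Finset (F × F) :=
  {p ∈ B m₀ ×ˢ B m₁ | p.1 ≠ p.2 ∧ p.1 + (p.2 - p.1) * ((m - m₀) / (m₁ - m₀)) ∈ B m}

/-- A line is determined by its values at `m₀` and `m₁`, which differ because its slope is nonzero.
-/
lemma card_lines_through_le (B : F → Finset F) (Λ : Finset (F × F)) (hΛ : ∀ l ∈ Λ, l.1 ≠ 0)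
    {m₀ m₁ m : F} (hm : m₀ ≠ m₁) :
    #{l ∈ Λ | l.1 * m₀ + l.2 ∈ B m₀ ∧ l.1 * m₁ + l.2 ∈ B m₁ ∧ l.1 * m + l.2 ∈ B m} ≤
      #(collinearPairs B m₀ m₁ m) := by
  have hm' : m₁ - m₀ ≠ 0 := sub_ne_zero.2 hm.symm
  refine card_le_card_of_injOn (fun l => (l.1 * m₀ + l.2, l.1 * m₁ + l.2)) ?_ ?_
  · intro l hl
    simp only [coe_filter, Set.mem_ofPred_eq] at hl
    obtain ⟨h, h0, h1, h2⟩ := hl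
    simp only [collinearPairs, coe_filter, mem_product, Set.mem_ofPred_eq]
    refine ⟨⟨h0, h1⟩, fun heq => hΛ l h ?_, ?_⟩
    · have : l.1 * (m₁ - m₀) = 0 := by linear_combination -heq
      exact (mul_eq_zero.1 this).resolve_right hm'
    · convert h2 using 1
      field_simp
      ring
  · intro l _ l' _ heq
    simp only [Prod.mk.injEq] at heq
    have h1 : (l.1 - l'.1) * (m₁ - m₀) = 0 := by linear_combination heq.2 - heq.1
    have h2 : l.1 = l'.1 := sub_eq_zero.1 ((mul_eq_zero.1 h1).resolve_right hm')
    refine Prod.ext h2 ?_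
    have := heq.1
    rw [h2] at this
    exact add_left_cancel this

/-- Many incidences between lines and points on a pencil of fibres yield two fibres of about average
size spanning many lines that meet many other fibres. -/
theorem exists_dense_collinearPairs (M : Finset F) (B : F → Finset F) (Λ : Finset (F × F))
    (hΛ : ∀ l ∈ Λ, l.1 ≠ 0) {n : ℕ} (hn : #Λ ≤ n) (hn0 : 0 < n) {D δ a v : ℝ} (hδ : 0 < δ)
    (ha : 0 < a) (hv : ∑ m ∈ M, (#(B m) : ℝ) = v) (hav : v = a * #M) (hM : M.Nonempty)
    (hinc : D * v ≤ ∑ l ∈ Λ, (#{m ∈ M | l.1 * m + l.2 ∈ B m} : ℝ))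
    (hDv : 4 * n ≤ D * v) (hδD : 4 * δ * #M * n ^ 2 * v ^ 2 ≤ (D * v) ^ 3) :
    ∃ m₀ m₁ : F, ∃ T ⊆ M, T.Nonempty ∧ m₀ ≠ m₁ ∧ m₀ ∉ T ∧ m₁ ∉ T ∧ δ * #M ≤ 4 * #T ∧
      δ * a ≤ 8 * #(B m₀) ∧ δ * a ≤ 8 * #(B m₁) ∧
      ∀ m ∈ T, δ * (#(B m₀) * #(B m₁)) ≤ 8 * #(collinearPairs B m₀ m₁ m) ∧
        δ * #(B m) ≤ 8 * a := by
  set k : F → ℝ := fun m => (#(B m) : ℝ) with hk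
  have hk0 : ∀ m, 0 ≤ k m := fun m => Nat.cast_nonneg _
  have hnpos : (0 : ℝ) < n := by exact_mod_cast hn0
  have hMpos : (0 : ℝ) < #M := by exact_mod_cast hM.card_pos
  have hvpos : 0 < v := by rw [hav]; positivity
  set dist : F × F × F → Prop := fun t => t.1 ≠ t.2.1 ∧ t.2.2 ≠ t.1 ∧ t.2.2 ≠ t.2.1 with hdist
  set c : F × F × F → ℝ := fun t => if dist t then (#(collinearPairs B t.1 t.2.1 t.2.2) : ℝ) else 0
    with hc
  have hc_le : ∀ t, c t ≤ k t.1 * k t.2.1 := by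
    intro t
    rw [hc]
    simp only
    split_ifs
    · have : #(collinearPairs B t.1 t.2.1 t.2.2) ≤ #(B t.1) * #(B t.2.1) := by
        rw [← card_product]
        exact card_filter_le _ _
      simp only [hk]
      exact_mod_cast this
    · exact mul_nonneg (hk0 _) (hk0 _)
  have hc_sum : δ * #M * v ^ 2 ≤ ∑ t ∈ M ×ˢ M ×ˢ M, c t := by
    have h1 := le_sum_card_distinct_triples Λ (fun l => {m ∈ M | l.1 * m + l.2 ∈ B m}) hn hinc hDv
      hn0
    have h2 : ∑ l ∈ Λ, (#{t ∈ {m ∈ M | l.1 * m + l.2 ∈ B m} ×ˢ {m ∈ M | l.1 * m + l.2 ∈ B m} ×ˢ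
        {m ∈ M | l.1 * m + l.2 ∈ B m} | t.1 ≠ t.2.1 ∧ t.2.2 ≠ t.1 ∧ t.2.2 ≠ t.2.1} : ℝ) ≤
        ∑ t ∈ M ×ˢ M ×ˢ M, c t := by
      have h3 : ∀ l ∈ Λ, (#{t ∈ {m ∈ M | l.1 * m + l.2 ∈ B m} ×ˢ {m ∈ M | l.1 * m + l.2 ∈ B m} ×ˢ
          {m ∈ M | l.1 * m + l.2 ∈ B m} | t.1 ≠ t.2.1 ∧ t.2.2 ≠ t.1 ∧ t.2.2 ≠ t.2.1} : ℝ) =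
          ∑ t ∈ M ×ˢ M ×ˢ M, if dist t ∧ l.1 * t.1 + l.2 ∈ B t.1 ∧ l.1 * t.2.1 + l.2 ∈ B t.2.1 ∧
            l.1 * t.2.2 + l.2 ∈ B t.2.2 then (1 : ℝ) else 0 := by
        intro l _
        rw [← sum_filter, sum_const, nsmul_eq_mul, mul_one]
        congr 2
        ext t
        simp only [mem_filter, mem_product, hdist]
        tauto
      rw [sum_congr rfl h3, sum_comm]
      refine sum_le_sum fun t _ => ?_
      by_cases ht : dist t
      · simp only [ht, true_and, hc, if_true]
        rw [← sum_filter, sum_const, nsmul_eq_mul, mul_one]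
        exact_mod_cast card_lines_through_le B Λ hΛ ht.1
      · simp [ht, hc]
    have h4 : (4 * n ^ 2 : ℝ) * (δ * #M * v ^ 2) ≤ 4 * n ^ 2 * ∑ t ∈ M ×ˢ M ×ˢ M, c t := by
      have := h1.trans (mul_le_mul_of_nonneg_left h2 (by positivity : (0 : ℝ) ≤ 4 * n ^ 2))
      linarith
    exact le_of_mul_le_mul_left h4 (by positivity)
  -- Each of the four terms has sum `|M| v^2`, so subtracting `δ / 8 * w` leaves at least half of
  -- the mass of `c`. Where `c` still dominates, the terms yield respectively the density of the
  -- graph, lower bounds for `B m₁` and `B m₀`, and an upper bound for `B m`.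
  set w : F × F × F → ℝ := fun t =>
    k t.1 * k t.2.1 + a * k t.1 + a * k t.2.1 + k t.1 * k t.2.1 * k t.2.2 / a with hw
  have hw_sum : ∑ t ∈ M ×ˢ M ×ˢ M, w t = 4 * #M * v ^ 2 := by
    have hs : ∑ m ∈ M, k m = v := hv
    simp only [hw, sum_product, sum_add_distrib, sum_const, ← sum_div, ← mul_sum, ← sum_mul, hs,
      nsmul_eq_mul, card_product, Nat.cast_mul]
    rw [hav]
    field_simp
    ring
  obtain ⟨⟨m₀, m₁⟩, hm, hlt⟩ : ∃ p ∈ M ×ˢ M,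
      δ / 4 * #M * (k p.1 * k p.2) < ∑ m ∈ M, (c (p.1, p.2, m) - δ / 8 * w (p.1, p.2, m)) := by
    refine exists_lt_of_sum_lt ?_
    have e1 : ∑ p ∈ M ×ˢ M, δ / 4 * #M * (k p.1 * k p.2) = δ / 4 * #M * v ^ 2 := by
      rw [← mul_sum, sum_product]
      simp only [← mul_sum, ← sum_mul]
      rw [show ∑ m ∈ M, k m = v from hv]
      ring
    have e2 : ∑ p ∈ M ×ˢ M, ∑ m ∈ M, (c (p.1, p.2, m) - δ / 8 * w (p.1, p.2, m)) =
        ∑ t ∈ M ×ˢ M ×ˢ M, (c t - δ / 8 * w t) := by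
      rw [sum_product, sum_product]
      refine sum_congr rfl fun x _ => ?_
      rw [sum_product]
    rw [e1, e2, sum_sub_distrib, ← mul_sum, hw_sum]
    have : 0 < δ * #M * v ^ 2 := by positivity
    linarith
  simp only at hlt
  set T : Finset F := {m ∈ M | dist (m₀, m₁, m) ∧ δ / 8 * w (m₀, m₁, m) ≤ c (m₀, m₁, m)} with hT
  have hkk := mul_nonneg (hk0 m₀) (hk0 m₁)
  have hTsum : ∑ m ∈ M, (c (m₀, m₁, m) - δ / 8 * w (m₀, m₁, m)) ≤ #T * (k m₀ * k m₁) := by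
    rw [← nsmul_eq_mul, ← sum_const, ← sum_filter_add_sum_filter_not M
      (fun m => dist (m₀, m₁, m) ∧ δ / 8 * w (m₀, m₁, m) ≤ c (m₀, m₁, m))]
    have hwnn : ∀ m, 0 ≤ δ / 8 * w (m₀, m₁, m) := by
      intro m
      have h0 := hk0 m₀
      have h1 := hk0 m₁
      have h2 := hk0 m
      simp only [hw]
      positivity
    have e1 : ∑ m ∈ M with ¬ (dist (m₀, m₁, m) ∧ δ / 8 * w (m₀, m₁, m) ≤ c (m₀, m₁, m)),
        (c (m₀, m₁, m) - δ / 8 * w (m₀, m₁, m)) ≤ 0 := by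
      refine sum_nonpos fun m hm => ?_
      have hm := (mem_filter.1 hm).2
      by_cases hd : dist (m₀, m₁, m)
      · have : ¬ δ / 8 * w (m₀, m₁, m) ≤ c (m₀, m₁, m) := fun h => hm ⟨hd, h⟩
        linarith
      · have : c (m₀, m₁, m) = 0 := by simp only [hc, hd, if_false]
        rw [this]
        linarith [hwnn m]
    have e2 : ∑ m ∈ M with dist (m₀, m₁, m) ∧ δ / 8 * w (m₀, m₁, m) ≤ c (m₀, m₁, m),
        (c (m₀, m₁, m) - δ / 8 * w (m₀, m₁, m)) ≤ ∑ _m ∈ T, k m₀ * k m₁ :=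
      sum_le_sum fun m _ => (sub_le_self _ (hwnn m)).trans (hc_le _)
    linarith
  have hlt2 := hlt.trans_le hTsum
  have hkkpos : 0 < k m₀ * k m₁ := by
    refine lt_of_le_of_ne hkk fun h => ?_
    rw [← h] at hlt2
    simp at hlt2
  have hk0pos : 0 < k m₀ := by
    refine lt_of_le_of_ne (hk0 _) fun h => ?_
    rw [← h, zero_mul] at hkkpos
    exact lt_irrefl _ hkkpos
  have hk1pos : 0 < k m₁ := by
    refine lt_of_le_of_ne (hk0 _) fun h => ?_
    rw [← h, mul_zero] at hkkpos
    exact lt_irrefl _ hkkpos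
  have hTcard : δ / 4 * #M < #T := lt_of_mul_lt_mul_right hlt2 hkk
  have hTne : T.Nonempty := by
    have : (0 : ℝ) < #T := lt_trans (by positivity) hTcard
    exact card_pos.1 (by exact_mod_cast this)
  have hbounds : ∀ m ∈ T, dist (m₀, m₁, m) ∧
      δ * (k m₀ * k m₁ + a * k m₀ + a * k m₁ + k m₀ * k m₁ * k m / a) ≤
        8 * #(collinearPairs B m₀ m₁ m) ∧
      (#(collinearPairs B m₀ m₁ m) : ℝ) ≤ k m₀ * k m₁ := by
    intro m hm
    obtain ⟨-, hd, h⟩ := mem_filter.1 hm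
    have h2 := hc_le (m₀, m₁, m)
    simp only [hc, hd, if_true, hw] at h h2
    exact ⟨hd, by linarith, h2⟩
  obtain ⟨m, hmT⟩ := hTne
  obtain ⟨hd, hb1, hb2⟩ := hbounds m hmT
  have hq : 0 ≤ k m₀ * k m₁ * k m / a := by
    have := hk0 m
    positivity
  have hak0 : 0 < δ * (a * k m₀) := by positivity
  have hak1 : 0 < δ * (a * k m₁) := by positivity
  have hdk : 0 < δ * (k m₀ * k m₁) := by positivity
  have hdq := mul_nonneg hδ.le hq
  refine ⟨m₀, m₁, T, filter_subset _ _, ⟨m, hmT⟩, hd.1, ?_, ?_, by linarith, ?_, ?_, ?_⟩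
  · intro h
    exact (hbounds _ h).1.2.1 rfl
  · intro h
    exact (hbounds _ h).1.2.2 rfl
  · refine le_of_mul_le_mul_right ?_ hk1pos
    change δ * a * k m₁ ≤ 8 * k m₀ * k m₁
    linarith
  · refine le_of_mul_le_mul_right ?_ hk0pos
    change δ * a * k m₀ ≤ 8 * k m₁ * k m₀
    linarith
  · intro m hm
    obtain ⟨-, h1, h2⟩ := hbounds m hm
    have hq : 0 ≤ δ * (k m₀ * k m₁ * k m / a) := by
      have := hk0 m
      positivity
    refine ⟨?_, ?_⟩
    · change δ * (k m₀ * k m₁) ≤ _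
      linarith
    · have h3 : δ * (k m₀ * k m₁ * k m / a) ≤ 8 * (k m₀ * k m₁) := by linarith
      rw [mul_div_assoc', div_le_iff₀ ha] at h3
      refine le_of_mul_le_mul_right ?_ hkkpos
      change δ * k m * (k m₀ * k m₁) ≤ 8 * a * (k m₀ * k m₁)
      linarith

end Pencils

/-! ### A line whose points have coordinates in a small subfield. -/

section SubfieldsFromPencils

open Finset
open scoped Pointwise

/-- Averaging over `O`; it serves to find one pair of points, hence one line, common to many graphs.
-/
lemma exists_mem_many {ι Ω : Type*} [DecidableEq Ω] (T : Finset ι) (O : Finset Ω)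
    (W : ι → Finset Ω) {b : ℝ} (hO : O.Nonempty) (hW : ∀ i ∈ T, W i ⊆ O)
    (hcard : ∀ i ∈ T, b * #O ≤ #(W i)) : ∃ ω ∈ O, b * #T ≤ #{i ∈ T | ω ∈ W i} := by
  refine exists_le_of_sum_le hO ?_
  have h1 : ∑ ω ∈ O, (#{i ∈ T | ω ∈ W i} : ℝ) = ∑ i ∈ T, (#(W i) : ℝ) := by
    have : ∀ i ∈ T, (#(W i) : ℝ) = ∑ ω ∈ O, if ω ∈ W i then (1 : ℝ) else 0 := by
      intro i hi
      rw [← sum_filter, sum_const, nsmul_eq_mul, mul_one]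
      congr 2
      ext ω
      simp only [mem_filter]
      exact ⟨fun h => ⟨hW i hi h, h⟩, fun h => h.2⟩
    rw [sum_congr rfl this, sum_comm]
    refine sum_congr rfl fun ω _ => ?_
    rw [← sum_filter, sum_const, nsmul_eq_mul, mul_one]
  rw [h1]
  calc ∑ ω ∈ O, b * (#T : ℝ) = ∑ i ∈ T, b * (#O : ℝ) := by
        rw [sum_const, sum_const, nsmul_eq_mul, nsmul_eq_mul]
        ring
    _ ≤ _ := sum_le_sum hcard

variable {F : Type*} [Field F] [DecidableEq F]

/-- Many incidences on a pencil of fibres force a line carrying many points whose positions, in a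
suitable projective coordinate, lie in an affine image of a small subfield. -/
theorem exists_subfield_of_pencil (M : Finset F) (B : F → Finset F) (Λ : Finset (F × F))
    (hΛ : ∀ l ∈ Λ, l.1 ≠ 0) {n : ℕ} (hn : #Λ ≤ n) (hn0 : 0 < n) {D δ Θ a v : ℝ} (hδ : 0 < δ)
    (hδΘ : δ * Θ = 512) (ha : 0 < a) (hv : ∑ m ∈ M, (#(B m) : ℝ) = v) (hav : v = a * #M)
    (hM : M.Nonempty) (hinc : D * v ≤ ∑ l ∈ Λ, (#{m ∈ M | l.1 * m + l.2 ∈ B m} : ℝ))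
    (hDv : 4 * n ≤ D * v) (hδD : 4 * δ * #M * n ^ 2 * v ^ 2 ≤ (D * v) ^ 3)
    (hκ₁ : 2 * ((Θ ^ 50) ^ 10 * (Θ ^ 24) ^ 30) * Θ ^ 2 ≤ a)
    (hκ₂ : 2 * ((Θ ^ 50) ^ 10 * (Θ ^ 24) ^ 30) * (Θ ^ 10 * a) * Θ ^ 12 < (#M : ℝ) ^ 2) :
    ∃ (R : Finset F) (G : Subfield F) (w₀ w₁ α β : F), w₀ ≠ w₁ ∧ α ≠ 0 ∧
      (∀ r ∈ R, 1 + r ≠ 0 ∧ (∃ m ∈ M, (w₀ + r * w₁) / (1 + r) ∈ B m) ∧ (r - β) / α ∈ G) ∧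
      (#M : ℝ) ≤ Θ ^ 6 * #R ∧ (Nat.card G : ℝ) < (#R : ℝ) ^ 2 := by
  obtain ⟨m₀, m₁, T, hTM, hTne, hm, h0T, h1T, hTcard, hB0, hB1, hT⟩ :=
    exists_dense_collinearPairs M B Λ hΛ hn hn0 hδ ha hv hav hM hinc hDv hδD
  have hΘ0 : 0 < Θ := by
    by_contra h
    push Not at h
    nlinarith
  have scale : ∀ x y : ℝ, δ * x ≤ 8 * y → 64 * x ≤ Θ * y := by
    intro x y h
    have := mul_le_mul_of_nonneg_right h hΘ0.le
    have e : δ * x * Θ = 512 * x := by rw [← hδΘ]; ring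
    linarith
  have hX := scale _ _ hB0
  have hY := scale _ _ hB1
  have pos_of : ∀ Z : Finset F, 64 * a ≤ Θ * #Z → (0 : ℝ) < #Z := by
    intro Z hZ
    by_contra h
    push Not at h
    nlinarith
  have hXpos := pos_of _ hX
  have hYpos := pos_of _ hY
  have hm' : m₁ - m₀ ≠ 0 := sub_ne_zero.2 hm.symm
  have hΘ : 64 ≤ Θ := by
    obtain ⟨m, hmT⟩ := hTne
    have h1 := scale _ _ (hT m hmT).1
    have h2 : (#(collinearPairs B m₀ m₁ m) : ℝ) ≤ #(B m₀) * #(B m₁) := by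
      have : #(collinearPairs B m₀ m₁ m) ≤ #(B m₀) * #(B m₁) := by
        rw [← card_product]
        exact card_filter_le _ _
      exact_mod_cast this
    have h3 : Θ * (#(collinearPairs B m₀ m₁ m) : ℝ) ≤ Θ * (#(B m₀) * #(B m₁)) := by gcongr
    exact le_of_mul_le_mul_right (h1.trans h3) (by positivity)
  -- In this coordinate the line through `u` over `m₀` and `w` over `m₁` has height `(u + r w) / (1
  -- + r)` over `m`. Hence `u + r w` lies in `(1 + r) B m`.
  set ρ : F → F := fun m => (m - m₀) / (m₁ - m) with hρ
  set μ : F → F := fun r => (m₀ + r * m₁) / (1 + r) with hμ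
  have hsub : ∀ m ∈ T, m₁ - m ≠ 0 := fun m hmT =>
    sub_ne_zero.2 fun h => h1T (h ▸ hmT)
  have hone : ∀ m ∈ T, 1 + ρ m = (m₁ - m₀) / (m₁ - m) := by
    intro m hmT
    have := hsub m hmT
    simp only [hρ]
    field_simp
    ring
  have hone0 : ∀ m ∈ T, 1 + ρ m ≠ 0 := by
    intro m hmT
    rw [hone m hmT]
    exact div_ne_zero hm' (hsub m hmT)
  have hμρ : ∀ m ∈ T, μ (ρ m) = m := by
    intro m hmT
    have h1 := hsub m hmT
    simp only [hμ]
    rw [hone m hmT]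
    simp only [hρ]
    field_simp
    ring
  have hcoord : ∀ m ∈ T, ∀ u w : F,
      u + (w - u) * ((m - m₀) / (m₁ - m₀)) = (u + ρ m * w) / (1 + ρ m) := by
    intro m hmT u w
    have h1 := hsub m hmT
    rw [hone m hmT]
    simp only [hρ]
    field_simp
    ring
  set TR := T.image ρ with hTR
  have hρinj : Set.InjOn ρ T := by
    intro x hx y hy hxy
    rw [← hμρ x hx, ← hμρ y hy, hxy]
  have hTRcard : #TR = #T := card_image_of_injOn hρinj
  have hEsub : ∀ r ∈ TR, collinearPairs B m₀ m₁ (μ r) ⊆ B m₀ ×ˢ B m₁ :=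
    fun r _ => filter_subset _ _
  have hEcard : ∀ r ∈ TR, 64 * (#(B m₀) * #(B m₁) : ℝ) ≤ Θ * #(collinearPairs B m₀ m₁ (μ r)) := by
    intro r hr
    obtain ⟨m, hmT, rfl⟩ := mem_image.1 hr
    rw [hμρ m hmT]
    exact scale _ _ (hT m hmT).1
  obtain ⟨V, r₀, hr₀, T', hT', hT'card, hV1, hVT, haV, hVa⟩ :=
    exists_dilateBounded_of_graphs (B m₀) (B m₁) TR (fun r => collinearPairs B m₀ m₁ (μ r))
      (fun r => (B (μ r)).image fun w => (1 + r) * w) ha hΘ (hTne.image _) (by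
        intro r hr
        obtain ⟨m, hmT, rfl⟩ := mem_image.1 hr
        exact div_ne_zero (sub_ne_zero.2 fun h => h0T (h ▸ hmT)) (hsub m hmT)) hEsub hEcard (by
        intro r hr p hp
        obtain ⟨m, hmT, rfl⟩ := mem_image.1 hr
        have h2 := (mem_filter.1 hp).2.2
        rw [hμρ m hmT] at h2 ⊢
        rw [hcoord m hmT] at h2
        exact mem_image.2 ⟨_, h2, mul_div_cancel₀ _ (hone0 m hmT)⟩) (by
        intro r hr
        obtain ⟨m, hmT, rfl⟩ := mem_image.1 hr
        rw [hμρ m hmT]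
        have h1 := scale _ _ (hT m hmT).2
        have h2 : (#((B m).image fun w => (1 + ρ m) * w) : ℝ) ≤ #(B m) := by
          exact_mod_cast card_image_le
        linarith) hX hY
  have hO : (B m₀ ×ˢ B m₁).Nonempty :=
    (card_pos.1 (by exact_mod_cast hXpos)).product (card_pos.1 (by exact_mod_cast hYpos))
  obtain ⟨⟨w₀, w₁⟩, -, hw⟩ := exists_mem_many T' (B m₀ ×ˢ B m₁)
    (fun r => collinearPairs B m₀ m₁ (μ r)) (b := 64 / Θ) hO (fun r hr => hEsub r (hT' hr)) (by
      intro r hr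
      rw [div_mul_eq_mul_div, div_le_iff₀ hΘ0, card_product]
      push_cast
      linarith [hEcard r (hT' hr)])
  rw [div_mul_eq_mul_div, div_le_iff₀ hΘ0] at hw
  set R : Finset F := {r ∈ T' | (w₀, w₁) ∈ collinearPairs B m₀ m₁ (μ r)} with hR
  have hRT' : R ⊆ T' := filter_subset _ _
  have hMR : (#M : ℝ) ≤ Θ ^ 6 * #R := by
    have h1 : 128 * (#M : ℝ) ≤ Θ * #T := by
      have := mul_le_mul_of_nonneg_right hTcard hΘ0.le
      have e : δ * #M * Θ = 512 * #M := by rw [← hδΘ]; ring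
      linarith
    rw [hTRcard] at hT'card
    have h2 : Θ * (#T : ℝ) ≤ Θ * (Θ ^ 4 * #T') := by gcongr
    have h3 : Θ ^ 5 * (64 * (#T' : ℝ)) ≤ Θ ^ 5 * (#R * Θ) := by gcongr
    have h4 : 0 ≤ (#M : ℝ) := Nat.cast_nonneg _
    have h5 : 0 ≤ Θ ^ 5 * (#T' : ℝ) := by positivity
    linarith
  have hMpos : (0 : ℝ) < #M := by exact_mod_cast hM.card_pos
  have hRpos : (0 : ℝ) < #R := by
    by_contra h
    push Not at h
    nlinarith [pow_pos hΘ0 6]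
  set κ := (Θ ^ 50) ^ 10 * (Θ ^ 24) ^ 30 with hκdef
  have hκpos : 0 < κ := by positivity
  have hκV : 2 * κ ≤ #V := by
    refine le_of_mul_le_mul_right (hκ₁.trans (haV.trans (le_of_eq (mul_comm _ _)))) ?_
    positivity
  have hκR : 2 * κ * #V < (#R : ℝ) ^ 2 := by
    have h1 : 2 * κ * #V * Θ ^ 12 ≤ 2 * κ * (Θ ^ 10 * a) * Θ ^ 12 := by gcongr
    have h2 : (#M : ℝ) ^ 2 ≤ (Θ ^ 6 * #R) ^ 2 := by gcongr
    have h3 : (Θ ^ 6 * (#R : ℝ)) ^ 2 = (#R : ℝ) ^ 2 * Θ ^ 12 := by ring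
    exact lt_of_mul_lt_mul_right ((h1.trans_lt hκ₂).trans_le (h2.trans_eq h3)) (by positivity)
  have hr₀0 : r₀ ≠ 0 := by
    obtain ⟨m, hmT, rfl⟩ := mem_image.1 hr₀
    exact div_ne_zero (sub_ne_zero.2 fun h => h0T (h ▸ hmT)) (hsub m hmT)
  have hRcard : #(R.image fun r => r / r₀) = #R :=
    card_image_of_injective _ fun x y h => (div_left_inj' hr₀0).1 h
  obtain ⟨G, hG, α, β, hα, hmem⟩ := exists_subfield_of_dilateBounded (V := V) (σ := Θ ^ 24)
    (τ := Θ ^ 50) (R.image fun r => r / r₀) (one_le_pow₀ (by linarith)) (one_le_pow₀ (by linarith))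
    hV1 (by
      intro t ht
      obtain ⟨r, hr, rfl⟩ := mem_image.1 ht
      exact hVT r (hRT' hr)) hκV (by rw [hRcard]; exact hκR)
  -- The subfield was found for the ratios `r / r₀`; the factor `r₀` undoes this normalisation.
  refine ⟨R, G, w₀, w₁, α * r₀, β * r₀, ?_, mul_ne_zero hα hr₀0, ?_, hMR, hG.trans_lt hκR⟩
  · obtain ⟨r, hr⟩ := card_pos.1 (by exact_mod_cast hRpos : 0 < #R)
    exact (mem_filter.1 (mem_filter.1 hr).2).2.1
  · intro r hr
    obtain ⟨m, hmT, rfl⟩ := mem_image.1 (hT' (hRT' hr))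
    refine ⟨hone0 m hmT, ⟨m, hTM hmT, ?_⟩, ?_⟩
    · have h2 := (mem_filter.1 (mem_filter.1 hr).2).2.2
      rw [hμρ m hmT, hcoord m hmT] at h2
      exact h2
    · have := hmem _ (mem_image_of_mem _ hr)
      convert this using 1
      field_simp

end SubfieldsFromPencils

/-! ### Projection from a rich point. -/

section PlaneToPencil

open Finset

variable {F : Type*} [Field F]

/-- A point `p` lies on the line `y = l.1 x + l.2`. -/
def OnGraph (p l : F × F) : Prop := p.2 = l.1 * p.1 + l.2

instance [DecidableEq F] (p l : F × F) : Decidable (OnGraph p l) := inferInstanceAs (Decidable (_ = _))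

lemma OnGraph.snd_sub {p q l : F × F} (hp : OnGraph p l) (hq : OnGraph q l) :
    q.2 - p.2 = l.1 * (q.1 - p.1) := by
  unfold OnGraph at *
  linear_combination hq - hp

lemma OnGraph.slope_eq {p q l : F × F} (hp : OnGraph p l) (hq : OnGraph q l) (h : q.1 ≠ p.1) :
    (q.2 - p.2) / (q.1 - p.1) = l.1 := by
  rw [hp.snd_sub hq, mul_div_cancel_right₀ _ (sub_ne_zero.2 h)]

lemma OnGraph.ext {p l l' : F × F} (h : OnGraph p l) (h' : OnGraph p l') (e : l.1 = l'.1) :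
    l = l' := by
  unfold OnGraph at *
  refine Prod.ext e ?_
  rw [e] at h
  exact add_left_cancel (h.symm.trans h')

lemma sum_card_filter_comm {ι κ : Type*} (s : Finset ι) (t : Finset κ) (r : ι → κ → Prop)
    [∀ i j, Decidable (r i j)] :
    ∑ i ∈ s, (#{j ∈ t | r i j} : ℝ) = ∑ j ∈ t, (#{i ∈ s | r i j} : ℝ) := by
  exact_mod_cast sum_card_bipartiteAbove_eq_sum_card_bipartiteBelow (s := s) (t := t) r

variable [DecidableEq F]

/-- After deleting points of low degree, some point sees at least an average number of points along
each line through it. -/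
lemma exists_rich_vertex (P Λ : Finset (F × F)) {n : ℕ} (hP : #P ≤ n) (hΛ : #Λ ≤ n) (hn : 0 < n)
    {Q : ℝ} (hQ : 0 < Q) (hinc : Q * n ≤ ∑ p ∈ P, (#{l ∈ Λ | OnGraph p l} : ℝ)) :
    ∃ P₁ ⊆ P, (∀ q ∈ P₁, Q ≤ 2 * (#{l ∈ Λ | OnGraph q l} : ℝ)) ∧ ∃ p ∈ P₁,
      Q / 2 * #{l ∈ Λ | OnGraph p l} ≤
        ∑ l ∈ Λ with OnGraph p l, (#{q ∈ P₁ | OnGraph q l} : ℝ) := by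
  set P₁ : Finset (F × F) := {p ∈ P | Q ≤ 2 * (#{l ∈ Λ | OnGraph p l} : ℝ)} with hP₁
  have hnpos : (0 : ℝ) < n := by exact_mod_cast hn
  set I := ∑ p ∈ P₁, (#{l ∈ Λ | OnGraph p l} : ℝ) with hI
  have hI₁ : Q * n / 2 ≤ I := by
    have h1 : ∑ p ∈ P with ¬ Q ≤ 2 * (#{l ∈ Λ | OnGraph p l} : ℝ),
        (#{l ∈ Λ | OnGraph p l} : ℝ) ≤ Q * n / 2 := by
      calc _ ≤ ∑ p ∈ P with ¬ Q ≤ 2 * (#{l ∈ Λ | OnGraph p l} : ℝ), Q / 2 := by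
            refine sum_le_sum fun p hp => ?_
            have := (mem_filter.1 hp).2
            push Not at this
            linarith
        _ ≤ n * (Q / 2) := by
            rw [sum_const, nsmul_eq_mul]
            gcongr
            exact (card_filter_le _ _).trans hP
        _ = _ := by ring
    have h2 := sum_filter_add_sum_filter_not P
      (fun p => Q ≤ 2 * (#{l ∈ Λ | OnGraph p l} : ℝ)) (fun p => (#{l ∈ Λ | OnGraph p l} : ℝ))
    linarith
  have hIpos : 0 < I := lt_of_lt_of_le (by positivity) hI₁
  refine ⟨P₁, filter_subset _ _, fun q hq => (mem_filter.1 hq).2, ?_⟩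
  refine exists_le_of_sum_le ?_ ?_
  · by_contra h
    rw [not_nonempty_iff_eq_empty] at h
    rw [hI, h, sum_empty] at hIpos
    exact lt_irrefl _ hIpos
  · have h1 : ∑ p ∈ P₁, ∑ l ∈ Λ with OnGraph p l, (#{q ∈ P₁ | OnGraph q l} : ℝ) =
        ∑ l ∈ Λ, (#{q ∈ P₁ | OnGraph q l} : ℝ) ^ 2 := by
      set K : F × F → ℝ := fun l => (#{q ∈ P₁ | OnGraph q l} : ℝ) with hK
      have e : ∀ p ∈ P₁, ∑ l ∈ Λ with OnGraph p l, K l =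
          ∑ l ∈ Λ, if OnGraph p l then K l else 0 := fun p _ => sum_filter _ _
      rw [sum_congr rfl e, sum_comm]
      refine sum_congr rfl fun l _ => ?_
      rw [← sum_filter, sum_const, nsmul_eq_mul, sq]
    have h2 : I = ∑ l ∈ Λ, (#{q ∈ P₁ | OnGraph q l} : ℝ) := sum_card_filter_comm _ _ _
    have h3 := sq_sum_le_card_mul_sum_sq (s := Λ) (f := fun l => (#{q ∈ P₁ | OnGraph q l} : ℝ))
    rw [h1, ← mul_sum]
    rw [← h2] at h3
    have h4 : (#Λ : ℝ) * ∑ l ∈ Λ, (#{q ∈ P₁ | OnGraph q l} : ℝ) ^ 2 ≤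
        n * ∑ l ∈ Λ, (#{q ∈ P₁ | OnGraph q l} : ℝ) ^ 2 :=
      mul_le_mul_of_nonneg_right (by exact_mod_cast hΛ) (sum_nonneg fun _ _ => sq_nonneg _)
    refine le_of_mul_le_mul_left ?_ hnpos
    have h5 : Q * n / 2 * I ≤ I * I := mul_le_mul_of_nonneg_right hI₁ hIpos.le
    linarith

/-- Projecting a rich point set from one of its points gives a rich pencil of fibres, whose
coordinates are reciprocals of differences of abscissae. -/
theorem exists_pencil (P Λ₀ : Finset (F × F)) {n : ℕ} (hP : #P ≤ n) (hΛ₀ : #Λ₀ ≤ n) (hn : 0 < n)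
    {Q : ℝ} (hQ : 4 ≤ Q) (hinc : Q * n ≤ ∑ p ∈ P, (#{l ∈ Λ₀ | OnGraph p l} : ℝ)) :
    ∃ (x₁ : F) (M : Finset F) (B : F → Finset F) (Λ : Finset (F × F)),
      (∀ l ∈ Λ, l.1 ≠ 0) ∧ #Λ ≤ n ∧ Q ≤ 2 * #M ∧ Q / 4 * #M ≤ ∑ m ∈ M, (#(B m) : ℝ) ∧
      ∑ m ∈ M, (#(B m) : ℝ) ≤ n ∧
      Q / 4 * ∑ m ∈ M, (#(B m) : ℝ) ≤ ∑ l ∈ Λ, (#{m ∈ M | l.1 * m + l.2 ∈ B m} : ℝ) ∧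
      ∀ m ∈ M, ∀ w ∈ B m, ∃ p ∈ P, p.1 ≠ x₁ ∧ w = (p.1 - x₁)⁻¹ := by
  obtain ⟨P₁, hP₁, hdeg, p, hp, hrich⟩ := exists_rich_vertex P Λ₀ hP hΛ₀ hn (by linarith) hinc
  set L : Finset (F × F) := {l ∈ Λ₀ | OnGraph p l} with hL
  set M : Finset F := L.image Prod.fst with hM
  have hinj : Set.InjOn Prod.fst (L : Set (F × F)) := by
    intro l hl l' hl' h
    exact (mem_filter.1 hl).2.ext (mem_filter.1 hl').2 h
  have hMcard : #M = #L := card_image_of_injOn hinj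
  set sl : F × F → F := fun q => (q.2 - p.2) / (q.1 - p.1) with hsl
  set V : Finset (F × F) := {q ∈ P₁ | q.1 ≠ p.1 ∧ sl q ∈ M} with hV
  set B : F → Finset F := fun m => {q ∈ V | sl q = m}.image fun q => (q.1 - p.1)⁻¹ with hB
  have hVne : ∀ q ∈ V, q.1 - p.1 ≠ 0 := fun q hq => sub_ne_zero.2 (mem_filter.1 hq).2.1
  have hBcard : ∀ m, #(B m) = #{q ∈ V | sl q = m} := by
    intro m
    refine card_image_of_injOn ?_
    intro q hq q' hq' h
    obtain ⟨hq, e⟩ := mem_filter.1 hq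
    obtain ⟨hq', e'⟩ := mem_filter.1 hq'
    have h1 : q.1 - p.1 = q'.1 - p.1 := inv_injective h
    have h2 : q.1 = q'.1 := by linear_combination h1
    refine Prod.ext h2 ?_
    have h3 := e.trans e'.symm
    simp only [hsl] at h3
    rw [← h1, div_left_inj' (hVne q hq)] at h3
    linear_combination h3
  have hBsum : ∑ m ∈ M, (#(B m) : ℝ) = #V := by
    simp_rw [hBcard]
    exact_mod_cast (card_eq_sum_card_fiberwise (f := sl) (s := V) (t := M)
      fun q hq => (mem_filter.1 hq).2.2).symm
  set c : F × F → F := fun l => l.1 * p.1 + l.2 - p.2 with hc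
  -- A point of `l` with `w = 1 / (q.1 - p.1)` is seen from `p` with slope `m = l.1 + c l * w`. So
  -- `l` becomes the graph of `w = m / c l - l.1 / c l`, of nonzero slope.
  set ψ : F × F → F × F := fun l => ((c l)⁻¹, -(l.1 / c l)) with hψ
  set N : Finset (F × F) := {l ∈ Λ₀ | ¬ OnGraph p l} with hN
  have hc0 : ∀ l ∈ N, c l ≠ 0 := by
    intro l hl h
    refine (mem_filter.1 hl).2 ?_
    unfold OnGraph
    simp only [hc] at h
    linear_combination -h
  have hψinj : Set.InjOn ψ N := by
    intro l hl l' hl' h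
    simp only [hψ, Prod.mk.injEq] at h
    have h1 : c l = c l' := inv_injective h.1
    have h2 := neg_injective h.2
    rw [← h1, div_left_inj' (hc0 l hl)] at h2
    refine Prod.ext h2 ?_
    simp only [hc] at h1
    rw [h2] at h1
    linear_combination h1
  refine ⟨p.1, M, B, N.image ψ, ?_, ?_, ?_, ?_, ?_, ?_, ?_⟩
  · intro l hl
    obtain ⟨l', hl', rfl⟩ := mem_image.1 hl
    exact inv_ne_zero (hc0 l' hl')
  · exact card_image_le.trans ((card_filter_le _ _).trans hΛ₀)
  · rw [hMcard]
    exact hdeg p hp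
  · rw [hM, sum_image hinj, card_image_of_injOn hinj]
    -- Only `p` itself is lost on a line through `p`; `Q / 2 - 1 ≥ Q / 4` because `Q ≥ 4`.
    have h1 : ∀ l ∈ L, (#{q ∈ P₁ | OnGraph q l} : ℝ) - 1 ≤ #(B l.1) := by
      intro l hl
      have hpl := (mem_filter.1 hl).2
      have h2 : #(({q ∈ P₁ | OnGraph q l}).erase p) ≤ #(B l.1) := by
        rw [hBcard]
        refine card_le_card fun q hq => ?_
        obtain ⟨hqp, hq⟩ := mem_erase.1 hq
        obtain ⟨hqP, hql⟩ := mem_filter.1 hq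
        have hx : q.1 ≠ p.1 := by
          intro h
          refine hqp (Prod.ext h ?_)
          have := hpl.snd_sub hql
          rw [h, sub_self, mul_zero] at this
          exact sub_eq_zero.1 this
        have hs : sl q = l.1 := hpl.slope_eq hql hx
        refine mem_filter.2 ⟨mem_filter.2 ⟨hqP, hx, ?_⟩, hs⟩
        rw [hs]
        exact mem_image_of_mem _ hl
      have h3 := pred_card_le_card_erase (s := {q ∈ P₁ | OnGraph q l}) (a := p)
      have h4 : (#{q ∈ P₁ | OnGraph q l} : ℝ) ≤ #(B l.1) + 1 := by
        exact_mod_cast (by omega : #{q ∈ P₁ | OnGraph q l} ≤ #(B l.1) + 1)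
      linarith
    have h2 := sum_le_sum h1
    rw [sum_sub_distrib, sum_const, nsmul_eq_mul, mul_one] at h2
    have h3 : (0 : ℝ) ≤ #L := Nat.cast_nonneg _
    nlinarith
  · rw [hBsum]
    exact_mod_cast (card_filter_le _ _).trans ((card_le_card hP₁).trans hP)
  · rw [hBsum, sum_image hψinj]
    have h1 : ∀ l ∈ N, (#{q ∈ V | OnGraph q l} : ℝ) ≤
        #{m ∈ M | (ψ l).1 * m + (ψ l).2 ∈ B m} := by
      intro l hl
      have hcl := hc0 l hl
      refine Nat.cast_le.2 (card_le_card_of_injOn sl ?_ ?_)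
      · intro q hq
        simp only [coe_filter, Set.mem_ofPred_eq] at hq
        obtain ⟨hqV, hql⟩ := hq
        have hx := hVne q hqV
        simp only [coe_filter, Set.mem_ofPred_eq]
        refine ⟨(mem_filter.1 hqV).2.2, mem_image.2 ⟨q, mem_filter.2 ⟨hqV, rfl⟩, ?_⟩⟩
        have hql : q.2 = l.1 * q.1 + l.2 := hql
        have e : sl q = l.1 + c l / (q.1 - p.1) := by
          simp only [hsl, hc]
          rw [hql]
          field_simp
          ring
        simp only [hψ]
        rw [e]
        field_simp
        ring
      · intro q hq q' hq' h
        simp only [coe_filter, Set.mem_ofPred_eq] at hq hq'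
        obtain ⟨hqV, hql⟩ := hq
        obtain ⟨hqV', hql'⟩ := hq'
        have hql : q.2 = l.1 * q.1 + l.2 := hql
        have hql' : q'.2 = l.1 * q'.1 + l.2 := hql'
        have hx := hVne q hqV
        have hx' := hVne q' hqV'
        have e : sl q = l.1 + c l / (q.1 - p.1) := by
          simp only [hsl, hc]
          rw [hql]
          field_simp
          ring
        have e' : sl q' = l.1 + c l / (q'.1 - p.1) := by
          simp only [hsl, hc]
          rw [hql']
          field_simp
          ring
        rw [e, e'] at h
        have h2 := add_left_cancel h
        rw [div_eq_div_iff hx hx'] at h2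
        have h3 := mul_left_cancel₀ hcl h2
        have h4 : q.1 = q'.1 := by linear_combination -h3
        exact Prod.ext h4 (by rw [hql, hql', h4])
    refine le_trans ?_ (sum_le_sum h1)
    rw [sum_card_filter_comm]
    -- At most one of the at least `Q / 2` lines through `q` passes through `p`.
    have h2 : ∀ q ∈ V, Q / 4 ≤ (#{l ∈ N | OnGraph q l} : ℝ) := by
      intro q hq
      have h3 : #{l ∈ Λ₀ | OnGraph q l} ≤ #{l ∈ N | OnGraph q l} + 1 := by
        have h4 : {l ∈ Λ₀ | OnGraph q l} ⊆
            {l ∈ N | OnGraph q l} ∪ {l ∈ Λ₀ | OnGraph q l ∧ OnGraph p l} := by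
          intro l hl
          obtain ⟨hl, hq⟩ := mem_filter.1 hl
          simp only [mem_union, mem_filter, hN]
          tauto
        have h5 : #{l ∈ Λ₀ | OnGraph q l ∧ OnGraph p l} ≤ 1 := by
          refine card_le_one.2 fun l hl l' hl' => ?_
          obtain ⟨-, a1, a2⟩ := mem_filter.1 hl
          obtain ⟨-, a1', a2'⟩ := mem_filter.1 hl'
          have hx := (mem_filter.1 hq).2.1
          exact a1.ext a1' ((a2.slope_eq a1 hx).symm.trans (a2'.slope_eq a1' hx))
        exact (card_le_card h4).trans ((card_union_le _ _).trans (by omega))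
      have h4 : (#{l ∈ Λ₀ | OnGraph q l} : ℝ) ≤ #{l ∈ N | OnGraph q l} + 1 := by exact_mod_cast h3
      have h5 := hdeg q (mem_filter.1 hq).1
      linarith
    have h3 := sum_le_sum h2
    rw [sum_const, nsmul_eq_mul] at h3
    linarith
  · intro m _ w hw
    obtain ⟨q, hq, rfl⟩ := mem_image.1 hw
    have hqV := mem_filter.1 (mem_filter.1 hq).1
    exact ⟨q, hP₁ hqV.1, hqV.2.1, rfl⟩

end PlaneToPencil

/-! ### Contradiction with the antifield property. -/

section IncidenceBound

open Finset

variable {F : Type*} [Field F] [Finite F]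

/-- A strong antifield contains few points whose positions in a projective coordinate lie in an
affine image of a given subfield. -/
lemma IsStrongAntifield₁.card_projective_le {lam : ℝ} {A : Set F} (hA : IsStrongAntifield₁ lam A)
    (R : Finset F) (G : Subfield F) {w₀ w₁ α β x₁ : F} (hw : w₀ ≠ w₁) (hα : α ≠ 0)
    (hR : ∀ r ∈ R, 1 + r ≠ 0 ∧ (∃ x ∈ A, x ≠ x₁ ∧ (w₀ + r * w₁) / (1 + r) = (x - x₁)⁻¹) ∧
      (r - β) / α ∈ G) :
    (#R : ℝ) ≤ max lam ((Nat.card G : ℝ) ^ (1 / 2 : ℝ)) := by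
  -- With `z = x - x₁`, solving `(w₀ + r w₁) / (1 + r) = 1 / z` gives `r = (1 - z w₀) / (z w₁ - 1)`.
  -- The coefficients are those of `(r - β) / α` as a function of `x`; the determinant is `α (w₀ -
  -- w₁)`.
  refine le_trans ?_ (hA.ncard_moebius_le G (α := -(w₀ + β * w₁))
    (β := 1 + β + (w₀ + β * w₁) * x₁) (γ := α * w₁) (δ := -(α * (1 + w₁ * x₁))) ?_)
  · choose! f hf using fun r hr => (hR r hr).2.1
    have key : ∀ r ∈ R, (f r - x₁) * w₁ - 1 ≠ 0 ∧
        r * ((f r - x₁) * w₁ - 1) = 1 - (f r - x₁) * w₀ := by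
      intro r hr
      obtain ⟨h1, -, -⟩ := hR r hr
      obtain ⟨-, hx, h⟩ := hf r hr
      have hz : f r - x₁ ≠ 0 := sub_ne_zero.2 hx
      rw [div_eq_iff h1, eq_comm, inv_mul_eq_iff_eq_mul₀ hz] at h
      have e : r * ((f r - x₁) * w₁ - 1) = 1 - (f r - x₁) * w₀ := by linear_combination -h
      refine ⟨fun h0 => hw ?_, e⟩
      rw [h0, mul_zero] at e
      have h2 : (f r - x₁) * (w₀ - w₁) = 0 := by linear_combination e - h0
      exact sub_eq_zero.1 ((mul_eq_zero.1 h2).resolve_left hz)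
    have hle := Set.ncard_le_ncard_of_injOn (s := (R : Set F)) (t := {x | x ∈ A ∧
        α * w₁ * x + -(α * (1 + w₁ * x₁)) ≠ 0 ∧
        (-(w₀ + β * w₁) * x + (1 + β + (w₀ + β * w₁) * x₁)) /
          (α * w₁ * x + -(α * (1 + w₁ * x₁))) ∈ G}) f ?_ ?_ (Set.toFinite _)
    · rw [Set.ncard_coe_finset] at hle
      exact_mod_cast hle
    · intro r hr
      obtain ⟨k1, k2⟩ := key r hr
      have e : α * w₁ * f r + -(α * (1 + w₁ * x₁)) = α * ((f r - x₁) * w₁ - 1) := by ring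
      refine ⟨(hf r hr).1, ?_, ?_⟩
      · rw [e]
        exact mul_ne_zero hα k1
      · have h := (hR r hr).2.2
        convert h using 1
        rw [e, div_eq_div_iff (mul_ne_zero hα k1) hα]
        linear_combination -α * k2
    · intro r hr r' hr' h
      obtain ⟨k1, k2⟩ := key r hr
      obtain ⟨-, k2'⟩ := key r' hr'
      rw [← h, ← k2] at k2'
      exact (mul_right_cancel₀ k1 k2').symm
  · have : -(w₀ + β * w₁) * -(α * (1 + w₁ * x₁)) - (1 + β + (w₀ + β * w₁) * x₁) * (α * w₁) =
        α * (w₀ - w₁) := by ring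
    rw [this]
    exact mul_ne_zero hα (sub_ne_zero.2 hw)

/-- Vertical lines contribute at most one incidence per point; the other lines are graphs. -/
lemma exists_graphs_incidences_le [DecidableEq F] (P : Finset (F × F)) (L : Finset (Set (F × F)))
    (hL : ∀ l ∈ L, IsPlaneLine l) :
    ∃ Λ : Finset (F × F), #Λ ≤ #L ∧
      incidences P L ≤ ∑ p ∈ P, #{l ∈ Λ | OnGraph p l} + #P := by
  classical
  have := Fintype.ofFinite F
  set φ : F × F → Set (F × F) := fun l => {p | OnGraph p l} with hφ
  have hφinj : Function.Injective φ := by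
    intro l l' h
    have h0 : ((0, l.2) : F × F) ∈ φ l' := by
      rw [← h]
      simp [hφ, OnGraph]
    have h1 : ((1, l.1 + l.2) : F × F) ∈ φ l' := by
      rw [← h]
      simp [hφ, OnGraph]
    simp only [hφ, Set.mem_ofPred_eq, OnGraph] at h0 h1
    refine Prod.ext ?_ ?_
    · linear_combination h1 - h0
    · linear_combination h0
  set Λ : Finset (F × F) := {l | φ l ∈ L} with hΛ
  refine ⟨Λ, card_le_card_of_injOn φ (fun l hl => (mem_filter.1 hl).2) hφinj.injOn, ?_⟩
  have h1 : incidences P L = ∑ p ∈ P, #{l ∈ L | p ∈ l} := by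
    unfold incidences
    rw [card_filter, sum_product]
    refine sum_congr rfl fun p _ => ?_
    rw [card_filter]
  have h2 : #P = ∑ _p ∈ P, 1 := by simp
  rw [h1, h2, ← sum_add_distrib]
  refine sum_le_sum fun p _ => ?_
  have hsub : {l ∈ L | p ∈ l} ⊆ ({l ∈ Λ | OnGraph p l}).image φ ∪ {{q | q.1 = p.1}} := by
    intro l hl
    obtain ⟨hlL, hpl⟩ := mem_filter.1 hl
    obtain ⟨a, b, c, hab, rfl⟩ := hL l hlL
    have hpl : a * p.1 + b * p.2 = c := hpl
    rw [mem_union]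
    by_cases hb : b = 0
    · right
      have ha : a ≠ 0 := hab.resolve_right (by simp [hb])
      rw [mem_singleton]
      ext q
      simp only [Set.mem_ofPred_eq]
      rw [← hpl, hb]
      simp [ha]
    · left
      have e : φ (-a / b, c / b) = {p : F × F | a * p.1 + b * p.2 = c} := by
        ext q
        simp only [hφ, OnGraph, Set.mem_ofPred_eq]
        constructor
        · intro h
          rw [h]
          field_simp
          ring
        · intro h
          rw [← h]
          field_simp
          ring
      refine mem_image.2 ⟨(-a / b, c / b), mem_filter.2 ⟨?_, ?_⟩, e⟩
      · rw [hΛ, mem_filter, e]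
        exact ⟨mem_univ _, hlL⟩
      · have : p ∈ φ (-a / b, c / b) := by
          rw [e]
          exact hpl
        exact this
  refine (card_le_card hsub).trans ((card_union_le _ _).trans ?_)
  rw [card_singleton]
  gcongr
  exact card_image_le

/-- A rich configuration of points and graphs of affine functions cannot have a strong antifield as
its set of abscissae. -/
theorem not_isStrongAntifield₂_of_rich [DecidableEq F] (P Λ₀ : Finset (F × F)) {n : ℕ} (hn0 : 0 < n)
    (hP : #P ≤ n) (hΛ₀ : #Λ₀ ≤ n) {t x u lam : ℝ} (ht : 1 ≤ t) (hx1 : 1 ≤ x)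
    (hnx : (n : ℝ) = x ^ 2 * t ^ 2)
    (hu : ((t ^ 4) ^ 50) ^ 10 * ((t ^ 4) ^ 24) ^ 30 * (t ^ 4) ^ 10 * (t ^ 4) ^ 12 = u)
    (hux : u * t ^ 2 ≤ x) (hlam : (t ^ 4) ^ 6 * lam ≤ x)
    (hinc : 63 * x * n ≤ ∑ p ∈ P, (#{l ∈ Λ₀ | OnGraph p l} : ℝ)) :
    ¬ IsStrongAntifield₂ lam (P : Set (F × F)) := by
  intro hA
  have ht0 : 0 < t := by linarith
  obtain ⟨κ, hκ⟩ : ∃ κ, κ = ((t ^ 4) ^ 50) ^ 10 * ((t ^ 4) ^ 24) ^ 30 := ⟨_, rfl⟩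
  have hκ1 : 1 ≤ κ := by
    rw [hκ]
    exact one_le_mul_of_one_le_of_one_le (one_le_pow₀ (one_le_pow₀ (one_le_pow₀ ht)))
      (one_le_pow₀ (one_le_pow₀ (one_le_pow₀ ht)))
  have hsub := fun (M : Finset F) (B : F → Finset F) (Λ : Finset (F × F)) hΛ hΛn D δ a v =>
    exists_subfield_of_pencil M B Λ hΛ (n := n) hΛn hn0 (D := D) (δ := δ) (Θ := t ^ 4) (a := a)
      (v := v)
  rw [← hκ] at hu hsub
  clear hκ
  have hκu : κ * (t ^ 4) ^ 2 ≤ u := by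
    have h1 : 1 ≤ t ^ 20 * (t ^ 4) ^ 15 :=
      one_le_mul_of_one_le_of_one_le (one_le_pow₀ ht) (one_le_pow₀ (one_le_pow₀ ht))
    have h2 : κ * (t ^ 4) ^ 2 * 1 ≤ κ * (t ^ 4) ^ 2 * (t ^ 20 * (t ^ 4) ^ 15) := by gcongr
    rw [← hu]
    linarith
  have hu1 : 0 < u := by
    rw [← hu]
    positivity
  have htu : u ≤ u * t ^ 2 := le_mul_of_one_le_right hu1.le (one_le_pow₀ ht)
  have htx : t ^ 2 ≤ x := by
    have h1 : 1 ≤ (t ^ 4) ^ 2 := one_le_pow₀ (one_le_pow₀ ht)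
    have h2 : 1 ≤ κ * (t ^ 4) ^ 2 := one_le_mul_of_one_le_of_one_le hκ1 h1
    exact (le_mul_of_one_le_left (by positivity) (h2.trans hκu)).trans hux
  obtain ⟨x₁, M, B, Λ, hΛ, hΛn, hM, hvM, hvn, hinc', hB⟩ :=
    exists_pencil P Λ₀ hP hΛ₀ hn0 (by linarith) hinc
  obtain ⟨v, hv⟩ : ∃ v, v = ∑ m ∈ M, (#(B m) : ℝ) := ⟨_, rfl⟩
  rw [← hv] at hvM hvn hinc'
  obtain ⟨d, hd⟩ : ∃ d, d = (#M : ℝ) := ⟨_, rfl⟩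
  rw [← hd] at hM hvM
  have hdx : 31 * x ≤ d := by linarith
  have hdpos : 0 < d := by linarith
  have hMne : M.Nonempty := card_pos.1 (by rw [hd] at hdpos; exact_mod_cast hdpos)
  have hvlow : 15 * x * d ≤ v := le_trans (by gcongr; linarith) hvM
  have hvpos : 0 < v := lt_of_lt_of_le (by positivity) hvlow
  obtain ⟨a, ha⟩ : ∃ a, a = v / d := ⟨_, rfl⟩
  have hav : v = a * d := by rw [ha, div_mul_cancel₀ _ hdpos.ne']
  have hapos : 0 < a := by rw [ha]; positivity
  have hax : 15 * x ≤ a := by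
    rw [ha, le_div_iff₀ hdpos]
    exact hvlow
  have hDv : 4 * (n : ℝ) ≤ 63 * x / 4 * v := by
    have h1 : 15 * x * (31 * x) ≤ v := le_trans (by gcongr) hvlow
    have h2 : 63 * x / 4 * (15 * x * (31 * x)) ≤ 63 * x / 4 * v := by gcongr
    have h3 : x ^ 2 * t ^ 2 ≤ x ^ 2 * x := by gcongr
    have h4 : 0 < x ^ 2 * x := by positivity
    rw [hnx]
    linarith
  -- This fixes `Θ = t ^ 4`: the loss `t ^ 4` in `n² = x^4 t^4` is exactly what `δ = 512 / t ^ 4`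
  -- compensates.
  have hδD : 4 * (512 / t ^ 4) * #M * (n : ℝ) ^ 2 * v ^ 2 ≤ (63 * x / 4 * v) ^ 3 := by
    rw [← hd, hnx]
    have e : 4 * (512 / t ^ 4) * d * (x ^ 2 * t ^ 2) ^ 2 * v ^ 2 = 2048 * d * x ^ 4 * v ^ 2 := by
      field_simp
      ring
    have h1 : 15 * x * d * (x ^ 3 * v ^ 2) ≤ v * (x ^ 3 * v ^ 2) := by gcongr
    have h2 : 0 ≤ x ^ 3 * v ^ 3 := by positivity
    rw [e]
    linarith
  have hκ₁ : 2 * κ * (t ^ 4) ^ 2 ≤ a := by linarith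
  -- After multiplication by `d`: `2 u a d = 2 u v ≤ 2 u x² t² ≤ 2 x³ < d³`.
  have hκ₂ : 2 * κ * ((t ^ 4) ^ 10 * a) * (t ^ 4) ^ 12 < (#M : ℝ) ^ 2 := by
    have e : 2 * κ * ((t ^ 4) ^ 10 * a) * (t ^ 4) ^ 12 = 2 * u * a := by
      rw [← hu]
      ring
    rw [e, ← hd]
    have h1 : a * d ≤ x ^ 2 * t ^ 2 := by
      rw [← hav, ← hnx]
      exact hvn
    have h3 : 2 * u * (a * d) ≤ 2 * u * (x ^ 2 * t ^ 2) := by gcongr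
    have h4 : 2 * x ^ 2 * (u * t ^ 2) ≤ 2 * x ^ 2 * x := by gcongr
    have h6 : (31 * x) ^ 3 ≤ d ^ 3 := by gcongr
    have h7 : 0 < x ^ 3 := by positivity
    refine lt_of_mul_lt_mul_right ?_ hdpos.le
    linarith
  obtain ⟨R, G, w₀, w₁, α, β, hw, hα, hR, hMR, hG⟩ :=
    hsub M B Λ hΛ hΛn (63 * x / 4) (512 / t ^ 4) a v (by positivity) (by field_simp) hapos hv.symm
      (by rw [← hd]; exact hav) hMne hinc' hDv hδD hκ₁ hκ₂
  have hle := hA.card_projective_le R G (x₁ := x₁) hw hα (by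
    intro r hr
    obtain ⟨h1, ⟨m, hm, hmB⟩, h2⟩ := hR r hr
    obtain ⟨p, hp, hpx, e⟩ := hB m hm _ hmB
    exact ⟨h1, ⟨p.1, ⟨p.2, hp⟩, hpx, e⟩, h2⟩)
  -- Either bound fails: `31 x ≤ |M| ≤ Θ^6 |R|` contradicts `Θ^6 lam ≤ x`, and `|G| < |R|²`
  -- contradicts `|R| ≤ |G|^{1/2}`.
  rcases le_max_iff.1 hle with h | h
  · rw [← hd] at hMR
    have h1 : (t ^ 4) ^ 6 * (#R : ℝ) ≤ (t ^ 4) ^ 6 * lam := by gcongr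
    linarith
  · have h1 : (#R : ℝ) ^ 2 ≤ ((Nat.card G : ℝ) ^ (1 / 2 : ℝ)) ^ 2 :=
      pow_le_pow_left₀ (Nat.cast_nonneg _) h 2
    rw [← Real.sqrt_eq_rpow, Real.sq_sqrt (Nat.cast_nonneg _)] at h1
    linarith

end IncidenceBound

/-! ### Choice of parameters. -/

theorem theorem1 :
    ∃ γ : ℝ, 0 < γ ∧ ∃ C : ℝ, 0 < C ∧
      ∀ (F : Type*) [Field F] [Finite F] (n : ℕ)
        (P : Finset (F × F)) (L : Finset (Set (F × F))),
        (∀ l ∈ L, IsPlaneLine l) →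
        P.card = n →
        L.card = n →
        IsStrongAntifield₂ (γ * (n : ℝ) ^ (2560 / 6419 : ℝ)) (P : Set (F × F)) →
        (incidences P L : ℝ) ≤ C * (n : ℝ) ^ (3 / 2 - 1 / 12838 : ℝ) := by
  -- `64 = 63 + 1`: the `1` pays for the at most `n` incidences with vertical lines.
  refine ⟨1, one_pos, 64, by norm_num, ?_⟩
  intro F _ _ n P L hL hP hLn hA
  classical
  obtain ⟨Λ, hΛ, hinc⟩ := exists_graphs_incidences_le P L hL
  rcases Nat.eq_zero_or_pos n with rfl | hn0
  · have hP0 : P = ∅ := Finset.card_eq_zero.1 hP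
    subst hP0
    simp only [Finset.sum_empty, Finset.card_empty, add_zero, Nat.le_zero] at hinc
    rw [hinc, Nat.cast_zero]
    positivity
  by_contra hcon
  push Not at hcon
  have hn1 : (1 : ℝ) ≤ n := by exact_mod_cast hn0
  obtain ⟨t, ht⟩ : ∃ t : ℝ, t = (n : ℝ) ^ (1 / 12838 : ℝ) := ⟨_, rfl⟩
  have hpow : ∀ k : ℕ, (n : ℝ) ^ ((k : ℝ) / 12838) = t ^ k := by
    intro k
    rw [ht, ← Real.rpow_natCast, ← Real.rpow_mul (Nat.cast_nonneg _)]
    congr 1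
    ring
  have ht1 : 1 ≤ t := by
    rw [ht]
    exact Real.one_le_rpow hn1 (by norm_num)
  have e1 : (n : ℝ) ^ (2560 / 6419 : ℝ) = t ^ 5120 := by
    rw [← hpow]
    congr 1
    norm_num
  have e2 : (n : ℝ) ^ (3 / 2 - 1 / 12838 : ℝ) = t ^ 19256 := by
    rw [← hpow]
    congr 1
    norm_num
  have e3 : (n : ℝ) = t ^ 12838 := by
    rw [← hpow]
    norm_num
  rw [e1, one_mul] at hA
  rw [e2] at hcon
  have mono : ∀ k l : ℕ, k ≤ l → t ^ k ≤ t ^ l := fun k l h => pow_le_pow_right₀ ht1 h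
  -- Here `x = n^{1/2} / t`. With `Θ = t^4`, the total loss is `u = Θ^{1220 + 10 + 12} = t^4968`.
  refine not_isStrongAntifield₂_of_rich P Λ hn0 hP.le (hΛ.trans hLn.le) (x := t ^ 6418)
    (u := t ^ 4968) ht1 (one_le_pow₀ ht1) ?_ ?_ ?_ ?_ ?_ hA
  · rw [e3, ← pow_mul, ← pow_add]
  · simp only [← pow_mul, ← pow_add]
  · rw [← pow_add]
    exact mono _ _ (by norm_num)
  · rw [← pow_mul, ← pow_add]
    exact mono _ _ (by norm_num)
  have e4 : t ^ 6418 * (n : ℝ) = t ^ 19256 := by rw [e3, ← pow_add]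
  have h1 : (n : ℝ) ≤ t ^ 19256 := by
    rw [e3]
    exact pow_le_pow_right₀ ht1 (by norm_num)
  have h2 : (incidences P L : ℝ) ≤
      ∑ p ∈ P, ((Finset.card {l ∈ Λ | OnGraph p l} : ℕ) : ℝ) + n := by
    rw [hP] at hinc
    exact_mod_cast hinc
  rw [mul_assoc, e4]
  linarith
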